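/- Consider the isothermal $p$-system $\partial_t\tau-\partial_x v=0$, $\partial_t v+\partial_x(1/\tau)=0$ for $u=(\tau,v)\in(0,\infty)\times\mathbb{R}$, with eigenvalues $\lambda_1(u)=-1/\tau$, $\lambda_2(u)=1/\tau$. Put $w=-\ln\tau$, let $W(s)=s$ for $s\le 0$ and $W(s)=2\sinh(s/2)$ for $s\ge 0$, and let the wave curves be $T_i(\sigma)(w,v)=(w+(-1)^{i-1}\sigma,\;v-W(\sigma))$, $i=1,2$. Here $\|\cdot\|_{BV(\mathbb{R})}$ denotes the (essential) total variation, with respect to the Euclidean norm of $\mathbb{R}^2$. **The modified front tracking scheme** with parameters $\varepsilon,\hat\lambda,\delta>0$. The initial datum is a piecewise constant function $\psi^0$ with finitely many jumps. The Riemann problem $(u_l,u_r)$ at a point $(\bar t,\bar x)$ is solved approximately as follows. Write $(w_r,v_r)=T_2(\sigma_2)\circ T_1(\sigma_1)(w_l,v_l)$; the wave of family $1$ has left state $u_l$, and that of family $2$ has left state $T_1(\sigma_1)u_l$. * If $\sigma_i=0$, there is no $i$-wave. * If $\sigma_i>0$, the $i$-wave is one $i$-shock front. It moves along a Lipschitz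 curve $h:[\bar t,\infty)\to\mathbb{R}$ with $h(\bar t)=\bar x$, where $-\hat\lambda\le\dot h<0$ a.e. if $i=1$ and $0<\dot h\le\hat\lambda$ a.e. if $i=2$. These curves (the shifts) are otherwise arbitrary. The shock is labelled *big* if $\sigma_i\ge\varepsilon$, or if an incoming front of the interaction is a big $i$-shock and $\sigma_i\ge\varepsilon/2$; otherwise it is labelled *small*. * If $\sigma_i<0$, the $i$-wave is split into $p_i=\lceil|\sigma_i|/\delta\rceil$ rarefaction fronts. The $l$-th one ($1\le l\le p_i$) joins the states obtained from the left state of the $i$-wave by $T_i(\frac{(l-1)\sigma_i}{p_i})$ and $T_i(\frac{l\sigma_i}{p_i})$. It starts at $(\bar t,\bar x)$ and moves with a constant speed $s$ with $\lambda_i(\text{its left state})<s\le\lambda_i(\text{its right state})$ (equality on the right is the unperturbed speed). At $t=0$ all Riemann problems at the jumps of $\psi^0$ are solved in this way. The fronts then propagate. Whenever two fronts collide at a time $t^*>0$ (an *interaction*), they are replaced by the approximate solution of the Riemann problem between the state on the left and the state on the right of the pair. It is assumed that at each time $t^*>0$ there is at most one collision, and that it involves exactly two fronts. This is repeated ad infinitum,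 and $\psi_\delta(t,x)$ denotes the resulting piecewise constant function (right-continuous in $x$). A priori the interaction times might accumulate at a finite time, beyond which $\psi_\delta$ would be undefined. **Lemma.** For all $A,V\in\mathbb{R}$ and $\beta>0$ there is a compact set $\mathcal{D}\subset(0,\infty)\times\mathbb{R}$, depending only on $A,V,\beta$, and for every $\hat\lambda>0$ there is a constant $M>0$, depending only on $A,V,\beta,\hat\lambda$, such that the following holds. Let $u^0=(\tau^0,v^0):\mathbb{R}\to\mathbb{R}^2$ satisfy $\|u^0\|_{L^\infty(\mathbb{R})}\le A$, $\|u^0\|_{BV(\mathbb{R})}\le V$ and $\tau^0\ge\beta$ a.e. Let $\varepsilon,\delta>0$, and let $\psi^0_\delta=(\tau^0_\delta,v^0_\delta)$ be a right-continuous piecewise constant function with finitely many jumps such that $\|\psi^0_\delta\|_{BV(\mathbb{R})}\le 2\|u^0\|_{BV(\mathbb{R})}$, $\|\psi^0_\delta\|_{L^\infty(\mathbb{R})}\le\|u^0\|_{L^\infty(\mathbb{R})}$ and $\tau^0_\delta\ge\beta$ everywhere. Then, for every run of the scheme with parameters $\varepsilon,\hat\lambda,\delta$ from $\psi^0_\delta$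 and every $T>0$: 1. the number of interactions in $[0,T]\times\mathbb{R}$ is finite; 2. $\psi_\delta(t,x)$ is defined and belongs to $\mathcal{D}$ for all $t\ge 0$, $x\in\mathbb{R}$; 3. $\|\psi_\delta(t,\cdot)\|_{BV(\mathbb{R})}\le M\|u^0\|_{BV(\mathbb{R})}$ for all $t\in[0,T]$; 4. $\|\psi_\delta(t,\cdot)-\psi_\delta(s,\cdot)\|_{L^1(\mathbb{R})}\le M|t-s|$ for $0<s<t<T$. -/

import Mathlib

open MeasureTheory Set

noncomputable section

/-! ### States, characteristic speeds and wave curves of the isothermal `p`-system -/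

/-- A state `u = (τ, v)` (specific volume, velocity), in `ℝ²` with the Euclidean norm. -/
abbrev State := EuclideanSpace ℝ (Fin 2)

/-- The specific volume `τ` of a state. -/
def specVol (u : State) : ℝ := u 0

/-- The velocity `v` of a state. -/
def vel (u : State) : ℝ := u 1

/-- The `(w, v)`-coordinates of a state, where `w = - ln τ`. -/
def toWV (u : State) : ℝ × ℝ := (-Real.log (specVol u), vel u)

/-- The state with given `(w, v)`-coordinates, i.e. `τ = exp (-w)`. -/
def ofWV (p : ℝ × ℝ) : State := !₂[Real.exp (-p.1), p.2]

/-- The two characteristic families. -/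
inductive Family
  | one
  | two

/-- The eigenvalues `λ₁ = -1/τ` and `λ₂ = 1/τ`. -/
def charSpeed : Family → State → ℝ
  | Family.one, u => -(1 / specVol u)
  | Family.two, u => 1 / specVol u

/-- `W(s) = s` for `s ≤ 0` and `W(s) = 2 sinh (s/2)` for `s ≥ 0`. -/
def waveFn (s : ℝ) : ℝ := if s ≤ 0 then s else 2 * Real.sinh (s / 2)

/-- The wave curves in the `(w, v)`-plane,
`T_i(σ)(w, v) = (w + (-1)^(i-1) σ, v - W(σ))`. -/
def waveCurve : Family → ℝ → ℝ × ℝ → ℝ × ℝ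
  | Family.one, σ, p => (p.1 + σ, p.2 - waveFn σ)
  | Family.two, σ, p => (p.1 - σ, p.2 - waveFn σ)

/-- The wave curves on states: `waveMap i σ u` is the state joined to the left state `u` by an
`i`-shock of strength `σ` if `σ > 0`, and by an `i`-rarefaction of strength `-σ` if `σ < 0`. -/
def waveMap (i : Family) (σ : ℝ) (u : State) : State := ofWV (waveCurve i σ (toWV u))

/-! ### Fronts and the approximate Riemann solver -/

/-- The kinds of fronts of the scheme. -/
inductive WaveKind
  | bigShock
  | smallShock
  | rarefaction

/-- A front: its family and kind, the states on its two sides, and its position as a function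
of time (meaningful from the time at which the front is created). -/
structure Front where
  family : Family
  kind : WaveKind
  left : State
  right : State
  path : ℝ → ℝ

/-- `h` is a Lipschitz curve on `[t₀, ∞)` starting at `x₀`, with velocity a.e. in `[-lam, 0)` for
the first family and in `(0, lam]` for the second. These are the curves that shock fronts of
either kind may follow. -/
def IsShockCurve (lam : ℝ) (i : Family) (t₀ x₀ : ℝ) (h : ℝ → ℝ) : Prop :=
  h t₀ = x₀ ∧ (∃ K, LipschitzOnWith K h (Ici t₀)) ∧
    ∀ᵐ t ∂(volume.restrict (Ioi t₀)),
      match i with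
      | Family.one => -lam ≤ deriv h t ∧ deriv h t < 0
      | Family.two => 0 < deriv h t ∧ deriv h t ≤ lam

/-- The rule by which an outgoing `i`-shock of strength `σ` is classified as big: either `σ ≥ ε`,
or one of the incoming fronts is a big `i`-shock and `σ ≥ ε / 2` (so a big shock turns small only
when its strength falls below `ε / 2`). At time `0` there are no incoming fronts. -/
def IsBig (ε : ℝ) (incoming : List Front) (i : Family) (σ : ℝ) : Prop :=
  ε ≤ σ ∨ (ε / 2 ≤ σ ∧ ∃ f ∈ incoming, f.family = i ∧ f.kind = WaveKind.bigShock)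

/-- `f` is an `i`-shock front of strength `σ` with left state `u`, created at `(t₀, x₀)`. -/
def IsShockFront (ε lam : ℝ) (incoming : List Front) (t₀ x₀ : ℝ) (i : Family) (u : State) (σ : ℝ)
    (f : Front) : Prop :=
  f.family = i ∧ f.left = u ∧ f.right = waveMap i σ u ∧
    ((IsBig ε incoming i σ ∧ f.kind = WaveKind.bigShock) ∨
      (¬ IsBig ε incoming i σ ∧ f.kind = WaveKind.smallShock)) ∧
    IsShockCurve lam i t₀ x₀ f.path

/-- `f` is the `l`-th (counted from `0`) of the `p` fronts into which an `i`-rarefaction with left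
state `u` and parameter `σ < 0`, created at `(t₀, x₀)`, is split. It travels with a constant speed
`s`. The unperturbed choice is `s = λ_i(f.right)`; the slight perturbations of it that are used to
avoid simultaneous or multiple collisions are the `s` with `λ_i(f.left) < s ≤ λ_i(f.right)`. -/
def IsRarefactionFront (t₀ x₀ : ℝ) (i : Family) (u : State) (σ : ℝ) (p l : ℕ) (f : Front) : Prop :=
  f.family = i ∧ f.kind = WaveKind.rarefaction ∧
    f.left = waveMap i ((l : ℝ) * σ / p) u ∧ f.right = waveMap i (((l : ℝ) + 1) * σ / p) u ∧
    ∃ s ∈ Ioc (charSpeed i f.left) (charSpeed i f.right), ∀ t, f.path t = x₀ + (t - t₀) * s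

/-- `F` is the list of fronts (from left to right) by which the solver replaces the `i`-wave with
left state `u` and parameter `σ`, created at `(t₀, x₀)`: nothing if `σ = 0`, one shock front if
`σ > 0`, and `⌈|σ| / δ⌉` rarefaction fronts of equal strength if `σ < 0`. -/
def IsWave (ε lam δ : ℝ) (incoming : List Front) (t₀ x₀ : ℝ) (i : Family) (u : State) (σ : ℝ)
    (F : List Front) : Prop :=
  (σ = 0 → F = []) ∧
  (0 < σ → ∃ f, F = [f] ∧ IsShockFront ε lam incoming t₀ x₀ i u σ f) ∧
  (σ < 0 → F.length = ⌈|σ| / δ⌉₊ ∧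
    ∀ l f, F[l]? = some f → IsRarefactionFront t₀ x₀ i u σ ⌈|σ| / δ⌉₊ l f)

/-- `F` is an approximate solution of the Riemann problem `(ul, ur)` at `(t₀, x₀)`: with
`ur = T₂(σ₂) (T₁(σ₁) ul)`, the fronts of the `1`-wave followed by those of the `2`-wave. -/
def IsRiemannFan (ε lam δ : ℝ) (incoming : List Front) (t₀ x₀ : ℝ) (ul ur : State)
    (F : List Front) : Prop :=
  ∃ (σ₁ σ₂ : ℝ) (F₁ F₂ : List Front),
    ur = waveMap Family.two σ₂ (waveMap Family.one σ₁ ul) ∧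
    IsWave ε lam δ incoming t₀ x₀ Family.one ul σ₁ F₁ ∧
    IsWave ε lam δ incoming t₀ x₀ Family.two (waveMap Family.one σ₁ ul) σ₂ F₂ ∧
    F = F₁ ++ F₂

/-! ### Piecewise constant data and the front tracking scheme -/

/-- A piecewise constant function with finitely many jumps: its value near `-∞`, and the positions
of its jumps in increasing order, each with the value to the right of it. -/
structure StepData where
  base : State
  jumps : List (ℝ × State)
  sorted : jumps.Pairwise (fun a b => a.1 < b.1)

/-- The (right-continuous) function described by a `StepData`. -/
def StepData.toFun (ψ₀ : StepData) (x : ℝ) : State :=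
  ψ₀.jumps.foldl (fun u j => if j.1 ≤ x then j.2 else u) ψ₀.base

/-- `F` is obtained by solving, at time `0`, all the Riemann problems of the step function with
left state `u` and the given jumps. -/
def IsInitialPattern (ε lam δ : ℝ) : State → List (ℝ × State) → List Front → Prop
  | _, [], F => F = []
  | u, j :: J, F => ∃ G H, F = G ++ H ∧ IsRiemannFan ε lam δ [] 0 j.1 u j.2 G ∧
      IsInitialPattern ε lam δ j.2 J H

/-- At time `t` the fronts are at distinct positions, in the order of the list. -/
def Separated (F : List Front) (t : ℝ) : Prop :=
  F.Pairwise (fun f g => f.path t < g.path t)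

/-- At time `t` exactly two fronts `f`, `g` of `F` collide, and no other collision takes place;
`F'` results from `F` by solving the Riemann problem of this collision. -/
def IsInteraction (ε lam δ t : ℝ) (F F' : List Front) : Prop :=
  ∃ (A B G : List Front) (f g : Front),
    F = A ++ f :: g :: B ∧ F' = A ++ (G ++ B) ∧
    f.path t = g.path t ∧ Separated (A ++ f :: B) t ∧
    IsRiemannFan ε lam δ [f, g] t (f.path t) f.left g.right G

/-- A (complete) run of the modified front tracking scheme with parameters `ε` (threshold of the
classification of shocks), `lam` (bound on the speed of shock curves), `δ` (discretization
parameter) and initial data `ψ₀`.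

The run has `N` interactions at times `t > 0`, where `N = ∞` is allowed, and then nothing is
required of the interaction times beyond their increasing: they may a priori accumulate at a finite
time. The `k`-th interaction (`1 ≤ k ≤ N`) takes place at `time k`; `fronts k` are the fronts, from
left to right, present between the `k`-th interaction (or time `0`, if `k = 0`) and the next one
(or for ever, if `k = N`). The entries with index larger than `N` are irrelevant. -/
structure FrontTracking (ε lam δ : ℝ) (ψ₀ : StepData) where
  N : ℕ∞
  time : ℕ → ℝ
  fronts : ℕ → List Front
  time_zero : time 0 = 0
  initial : IsInitialPattern ε lam δ ψ₀.base ψ₀.jumps (fronts 0)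
  time_lt : ∀ k : ℕ, (k : ℕ∞) < N → time k < time (k + 1)
  separated : ∀ k : ℕ, (k : ℕ∞) < N → ∀ t ∈ Ioo (time k) (time (k + 1)), Separated (fronts k) t
  interaction : ∀ k : ℕ, (k : ℕ∞) < N →
    IsInteraction ε lam δ (time (k + 1)) (fronts k) (fronts (k + 1))
  separated_last : ∀ k : ℕ, (k : ℕ∞) = N → ∀ t, time k < t → Separated (fronts k) t

namespace FrontTracking

variable {ε lam δ : ℝ} {ψ₀ : StepData}

/-- Time `t` lies between the `k`-th interaction (included) and the next one (excluded). -/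
def IsStage (P : FrontTracking ε lam δ ψ₀) (t : ℝ) (k : ℕ) : Prop :=
  (k : ℕ∞) ≤ P.N ∧ P.time k ≤ t ∧ ((k : ℕ∞) < P.N → t < P.time (k + 1))

open Classical in
/-- The approximation `ψ_δ(t, x)` generated by the run: the state to the right of the last front
at or to the left of `x` (the value on the fronts is fixed by right-continuity). At a time that is
not reached by the run, the value is `0`, which is not a state of positive specific volume. -/
def approx (P : FrontTracking ε lam δ ψ₀) (t x : ℝ) : State :=
  if h : ∃ k, P.IsStage t k then
    (P.fronts h.choose).foldl (fun u f => if f.path t ≤ x then f.right else u) ψ₀.base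
  else 0

/-- The set of (indices of) interactions of the run in `[0, T] × ℝ`. -/
def interactions (P : FrontTracking ε lam δ ψ₀) (T : ℝ) : Set ℕ :=
  {k | 1 ≤ k ∧ (k : ℕ∞) ≤ P.N ∧ P.time k ≤ T}

end FrontTracking

/-- The total variation of (the a.e.-equivalence class of) a function on `ℝ`: the smallest
pointwise variation of a representative. -/
def bvNorm (f : ℝ → State) : ENNReal :=
  ⨅ (g : ℝ → State) (_ : g =ᵐ[volume] f), eVariationOn g univ

end

/-!
Let `σ` be the signed strength of a front (positive for shocks), measured by the jump of `w`. In
the `(w, v)`-plane the wave curves are invariant under translations, so an interaction only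
involves the strengths of the two fronts. If a `2`-front meets a `1`-front, they cross and keep
their strengths (`strengths_unique`). If two fronts of the same family meet, they produce a
transmitted wave of this family and a reflected wave of the other one. The functional `potential`,
in which rarefactions are counted with weight `1` and shocks with a weight `ξ > 1` close to `1`,
does not increase (`same_family_estimate`); how close to `1` the weight has to be depends on an a
priori bound for the functional, through the Lipschitz constant of `W`. The remaining pairs never
collide.

The functional controls the states, the speeds of the rarefactions and the total variation;
initially it is bounded by the total variation of the datum, with a constant depending on the
lower bound of the specific volume. This gives the compact set, the bound of the variation and, as
the speeds are bounded, the Lipschitz continuity in `L¹`.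

The point is that interaction times do not accumulate. An interaction can increase the number of
fronts only if it produces a reflected rarefaction stronger than `δ`, which uses up a fixed amount
of the functional (`collision_estimate`). Hence from some interaction on the number of fronts is
constant, and every interaction replaces two fronts by a `1`-front on the left and a `2`-front on
the right. If there were infinitely many of them in bounded time, consider a maximal block of
neighbouring positions that interact infinitely often. Its leftmost front eventually interacts
only with its right neighbour, so that it always is a `1`-front and moves to the left; likewise
the rightmost one moves to the right. So they move apart, while infinitely many collisions in the
block and the bounded speeds force all its fronts to converge to the same point
(`no_accumulation`). Only the signs of the speeds and an upper bound for them are needed, so the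
argument applies to arbitrary shifts of the shocks.
-/

noncomputable section

/-! ### The wave function `W` -/

lemma waveFn_of_nonpos {s : ℝ} (h : s ≤ 0) : waveFn s = s := if_pos h

lemma waveFn_of_nonneg {s : ℝ} (h : 0 ≤ s) : waveFn s = 2 * Real.sinh (s / 2) := by
  rcases h.eq_or_lt with rfl | h
  · simp [waveFn]
  · exact if_neg h.not_ge

@[simp] lemma waveFn_zero : waveFn 0 = 0 := waveFn_of_nonpos le_rfl

/-- `s ↦ W(s) - s` is nondecreasing. -/
lemma sub_le_waveFn_sub {x y : ℝ} (h : x ≤ y) : y - x ≤ waveFn y - waveFn x := by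
  have key : ∀ x y : ℝ, 0 ≤ x → x ≤ y → y - x ≤ waveFn y - waveFn x := by
    intro x y hx hxy
    rw [waveFn_of_nonneg hx, waveFn_of_nonneg (hx.trans hxy)]
    have := Real.sinh_sub_id_strictMono.monotone (show x / 2 ≤ y / 2 by linarith)
    linarith
  rcases le_total x 0 with hx | hx
  · rcases le_total y 0 with hy | hy
    · rw [waveFn_of_nonpos hx, waveFn_of_nonpos hy]
    · have := key 0 y le_rfl hy
      rw [waveFn_of_nonpos hx]
      simp only [waveFn_zero] at this
      linarith
  · exact key x y hx h

lemma waveFn_strictMono : StrictMono waveFn := fun x y h => by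
  have := sub_le_waveFn_sub h.le
  linarith

lemma self_le_waveFn {x : ℝ} (h : 0 ≤ x) : x ≤ waveFn x := by
  simpa using sub_le_waveFn_sub h

/-- `W` is superadditive on `[0, ∞)`: this makes the reflected wave of the interaction of two
shocks of the same family a rarefaction. -/
lemma waveFn_add_le {a b : ℝ} (ha : 0 ≤ a) (hb : 0 ≤ b) :
    waveFn a + waveFn b ≤ waveFn (a + b) := by
  rw [waveFn_of_nonneg ha, waveFn_of_nonneg hb, waveFn_of_nonneg (add_nonneg ha hb), add_div,
    Real.sinh_add]
  have h1 : 0 ≤ Real.sinh (a / 2) := Real.sinh_nonneg_iff.2 (by linarith)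
  have h2 : 0 ≤ Real.sinh (b / 2) := Real.sinh_nonneg_iff.2 (by linarith)
  nlinarith [Real.one_le_cosh (a / 2), Real.one_le_cosh (b / 2)]

/-- `W` is Lipschitz with constant `cosh R` on `(-∞, 2R]`. -/
lemma waveFn_sub_le {x y R : ℝ} (h : x ≤ y) (hy : y ≤ 2 * R) :
    waveFn y - waveFn x ≤ Real.cosh R * (y - x) := by
  have key : ∀ x y : ℝ, 0 ≤ x → x ≤ y → y ≤ 2 * R →
      waveFn y - waveFn x ≤ Real.cosh R * (y - x) := by
    intro x y hx hxy hy
    rw [waveFn_of_nonneg hx, waveFn_of_nonneg (hx.trans hxy)]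
    have := (convex_Icc (x / 2) (y / 2)).image_sub_le_mul_sub_of_deriv_le
      (f := Real.sinh) (C := Real.cosh R) Real.continuous_sinh.continuousOn
      Real.differentiable_sinh.differentiableOn (by
        intro z hz
        rw [interior_Icc] at hz
        rw [Real.deriv_sinh, Real.cosh_le_cosh, abs_of_nonneg (by linarith [hz.1]),
          abs_of_nonneg (by linarith)]
        linarith [hz.2])
      (x / 2) (left_mem_Icc.2 (by linarith)) (y / 2) (right_mem_Icc.2 (by linarith)) (by linarith)
    linarith
  rcases le_total x 0 with hx | hx
  · rcases le_total y 0 with hy' | hy'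
    · rw [waveFn_of_nonpos hx, waveFn_of_nonpos hy']
      nlinarith [Real.one_le_cosh R]
    · have := key 0 y le_rfl hy' hy
      rw [waveFn_of_nonpos hx]
      simp only [waveFn_zero] at this
      nlinarith [Real.one_le_cosh R]
  · exact key x y hx h hy

lemma abs_waveFn_le {x R : ℝ} (hx : x ≤ 2 * R) : |waveFn x| ≤ Real.cosh R * |x| := by
  rcases le_total x 0 with h | h
  · rw [waveFn_of_nonpos h]
    nlinarith [Real.one_le_cosh R, abs_nonneg x]
  · rw [abs_of_nonneg h, abs_of_nonneg (h.trans (self_le_waveFn h))]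
    simpa using waveFn_sub_le h hx

/-! ### Algebra of the interactions -/

/-- The weight of a wave of signed strength `σ` in the interaction functional: shocks (`σ > 0`)
are counted with a factor `ξ`, rarefactions with a factor `1`. -/
def weight (ξ σ : ℝ) : ℝ := if 0 < σ then ξ * σ else -σ

lemma weight_of_nonneg {ξ σ : ℝ} (h : 0 ≤ σ) : weight ξ σ = ξ * σ := by
  rcases h.eq_or_lt with rfl | h
  · simp [weight]
  · exact if_pos h

lemma weight_of_nonpos {ξ σ : ℝ} (h : σ ≤ 0) : weight ξ σ = -σ := if_neg h.not_gt

lemma abs_le_weight {ξ σ : ℝ} (hξ : 1 ≤ ξ) : |σ| ≤ weight ξ σ := by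
  rcases le_total σ 0 with h | h
  · rw [weight_of_nonpos h, abs_of_nonpos h]
  · rw [weight_of_nonneg h, abs_of_nonneg h]
    nlinarith

lemma weight_nonneg {ξ σ : ℝ} (hξ : 1 ≤ ξ) : 0 ≤ weight ξ σ :=
  (abs_nonneg σ).trans (abs_le_weight hξ)

lemma weight_le_mul_abs {ξ C σ : ℝ} (hξ : ξ ≤ C) (hC : 1 ≤ C) : weight ξ σ ≤ C * |σ| := by
  rcases le_total σ 0 with h | h
  · rw [weight_of_nonpos h, abs_of_nonpos h]
    nlinarith
  · rw [weight_of_nonneg h, abs_of_nonneg h]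
    nlinarith

/-- The unique decomposition of a Riemann problem: the wave curves determine the strengths. -/
lemma strengths_unique {a b c d : ℝ} (h₁ : a - b = c - d)
    (h₂ : waveFn a + waveFn b = waveFn c + waveFn d) : a = c ∧ b = d := by
  have : a = c := by
    rcases lt_trichotomy a c with h | h | h
    · have h3 := waveFn_strictMono h
      have h4 := waveFn_strictMono (show b < d by linarith)
      linarith
    · exact h
    · have h3 := waveFn_strictMono h
      have h4 := waveFn_strictMono (show d < b by linarith)
      linarith
  exact ⟨this, by linarith⟩

/-- The strengths of the two waves solving a Riemann problem are bounded by the jumps of `w` and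
of `v` across it. -/
lemma abs_add_abs_le {a b : ℝ} :
    |a| + |b| ≤ |a - b| + |waveFn a + waveFn b| := by
  have h0 : ∀ {x : ℝ}, x ≤ 0 → waveFn x = x := waveFn_of_nonpos
  have h1 : ∀ {x : ℝ}, 0 ≤ x → x ≤ waveFn x := self_le_waveFn
  rcases le_total a 0 with ha | ha <;> rcases le_total b 0 with hb | hb
  · rw [h0 ha, h0 hb, abs_of_nonpos ha, abs_of_nonpos hb]
    linarith [neg_abs_le (a + b), abs_nonneg (a - b)]
  · rw [abs_of_nonpos ha, abs_of_nonneg hb]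
    linarith [neg_abs_le (a - b), abs_nonneg (waveFn a + waveFn b)]
  · rw [abs_of_nonneg ha, abs_of_nonpos hb]
    linarith [le_abs_self (a - b), abs_nonneg (waveFn a + waveFn b)]
  · rw [abs_of_nonneg ha, abs_of_nonneg hb]
    linarith [le_abs_self (waveFn a + waveFn b), abs_nonneg (a - b), h1 ha, h1 hb]

/-- A shock `a` meets a rarefaction `b` of the same family. Here `t` is the transmitted and `r` the
reflected wave, which is a shock. -/
lemma shock_rarefaction_estimate {R a b t r : ℝ} (ha : 0 < a) (hb : b < 0) (haR : a ≤ 2 * R)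
    (h₁ : t = a + b + r) (h₂ : waveFn a + waveFn b = waveFn t + waveFn r) :
    b ≤ t ∧ 0 ≤ r ∧ weight (1 + 1 / Real.cosh R) t + weight (1 + 1 / Real.cosh R) r ≤
      weight (1 + 1 / Real.cosh R) a + weight (1 + 1 / Real.cosh R) b := by
  set K := Real.cosh R
  have hK : 1 ≤ K := Real.one_le_cosh R
  have hWb : waveFn b = b := waveFn_of_nonpos hb.le
  have hr : 0 ≤ r := by
    by_contra! hr
    have h3 := waveFn_strictMono (show t < a + b by linarith)
    have h4 := sub_le_waveFn_sub (show a + b ≤ a by linarith)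
    have h5 := waveFn_strictMono hr
    rw [waveFn_zero] at h5
    linarith
  have hWr := self_le_waveFn hr
  refine ⟨by linarith, hr, ?_⟩
  rw [weight_of_nonneg hr, weight_of_nonneg ha.le, weight_of_nonpos hb.le]
  have hinv : 0 < 1 / K := by positivity
  rcases le_total 0 t with ht | ht
  · rw [weight_of_nonneg ht]
    -- `y = |b| - r` is the strength that the shock loses
    have hy : 0 ≤ -b - r := by
      by_contra! hy
      have := waveFn_strictMono (show a < t by linarith)
      linarith
    have hlip : waveFn a - waveFn t ≤ K * (a - t) := waveFn_sub_le (by linarith) haR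
    have h6 : 2 * r ≤ (K - 1) * (-b - r) := by
      subst h₁; nlinarith
    have h7 : 1 / K * (2 * r) ≤ -b - r := by
      rw [div_mul_eq_mul_div, div_le_iff₀ (by positivity)]
      nlinarith
    subst h₁
    nlinarith
  · rw [weight_of_nonpos ht]
    have hWt : waveFn t = t := waveFn_of_nonpos ht
    have hra : r ≤ a := by
      by_contra! hra
      have := waveFn_strictMono hra
      linarith
    have : 1 / K ≤ 1 := by rw [div_le_one (by positivity)]; exact hK
    subst h₁
    nlinarith

/-- Two waves `a`, `b` of the same family interact, not both of them rarefactions. Here `t` is the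
transmitted and `r` the reflected wave. The functional does not increase; the transmitted wave, if
it is a rarefaction, is not stronger than the incoming one; and the functional decreases by a
definite amount whenever the reflected wave is a large rarefaction. -/
lemma same_family_estimate {R a b t r δ : ℝ} (ha : a ≠ 0) (hb : b ≠ 0) (hab : 0 < a ∨ 0 < b)
    (haδ : -δ ≤ a) (hbδ : -δ ≤ b) (hδ : 0 < δ) (haR : a ≤ 2 * R) (hbR : b ≤ 2 * R)
    (h₁ : t - r = a + b) (h₂ : waveFn a + waveFn b = waveFn t + waveFn r) :
    -δ ≤ t ∧
    weight (1 + 1 / Real.cosh R) t + weight (1 + 1 / Real.cosh R) r ≤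
      weight (1 + 1 / Real.cosh R) a + weight (1 + 1 / Real.cosh R) b ∧
    (-δ ≤ r ∨ weight (1 + 1 / Real.cosh R) t + weight (1 + 1 / Real.cosh R) r + δ / Real.cosh R ≤
      weight (1 + 1 / Real.cosh R) a + weight (1 + 1 / Real.cosh R) b) := by
  have hK : 1 ≤ Real.cosh R := Real.one_le_cosh R
  rcases lt_or_gt_of_ne ha with ha | ha
  · have hb : 0 < b := hab.resolve_left ha.le.not_gt
    obtain ⟨h3, h4, h5⟩ := shock_rarefaction_estimate (t := t) (r := r) hb ha hbR
      (by linarith) (by linarith)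
    exact ⟨by linarith, by linarith, Or.inl (by linarith)⟩
  rcases lt_or_gt_of_ne hb with hb | hb
  · obtain ⟨h3, h4, h5⟩ := shock_rarefaction_estimate (t := t) (r := r) ha hb haR
      (by linarith) (by linarith)
    exact ⟨by linarith, by linarith, Or.inl (by linarith)⟩
  set K := Real.cosh R
  have hr : r ≤ 0 := by
    by_contra! hr
    have h3 := waveFn_strictMono (show a + b < t by linarith)
    have h4 := waveFn_add_le ha.le hb.le
    have h5 := waveFn_strictMono hr
    rw [waveFn_zero] at h5
    linarith
  have ht : 0 ≤ t := by
    by_contra! ht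
    rw [waveFn_of_nonpos ht.le, waveFn_of_nonpos hr] at h₂
    linarith [self_le_waveFn ha.le, self_le_waveFn hb.le]
  rw [weight_of_nonneg ht, weight_of_nonpos hr, weight_of_nonneg ha.le, weight_of_nonneg hb.le]
  have hinv : 0 < 1 / K := by positivity
  obtain rfl : t = a + b + r := by linarith
  refine ⟨by linarith, by nlinarith, ?_⟩
  rcases le_or_gt (-δ) r with h | h
  · exact Or.inl h
  · right
    rw [div_eq_mul_one_div δ K]
    nlinarith

/-! ### States in the `(w, v)`-plane -/

@[simp] lemma specVol_ofWV (p : ℝ × ℝ) : specVol (ofWV p) = Real.exp (-p.1) := by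
  simp [specVol, ofWV]

@[simp] lemma vel_ofWV (p : ℝ × ℝ) : vel (ofWV p) = p.2 := by
  simp [vel, ofWV]

@[simp] lemma toWV_ofWV (p : ℝ × ℝ) : toWV (ofWV p) = p := by
  simp [toWV]

lemma ofWV_toWV {u : State} (h : 0 < specVol u) : ofWV (toWV u) = u := by
  ext i
  fin_cases i
  · simp only [ofWV, toWV, neg_neg, Real.exp_log h]
    rfl
  · simp [ofWV, toWV, vel]

@[simp] lemma toWV_waveMap (i : Family) (σ : ℝ) (u : State) :
    toWV (waveMap i σ u) = waveCurve i σ (toWV u) := toWV_ofWV _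

lemma specVol_waveMap_pos (i : Family) (σ : ℝ) (u : State) : 0 < specVol (waveMap i σ u) := by
  rw [waveMap, specVol_ofWV]
  exact Real.exp_pos _

@[simp] lemma waveCurve_zero (i : Family) (p : ℝ × ℝ) : waveCurve i 0 p = p := by
  cases i <;> simp [waveCurve]

lemma waveMap_zero (i : Family) {u : State} (h : 0 < specVol u) : waveMap i 0 u = u := by
  rw [waveMap, waveCurve_zero, ofWV_toWV h]

lemma waveMap_add_of_nonpos (i : Family) {a b : ℝ} (ha : a ≤ 0) (hb : b ≤ 0) (u : State) :
    waveMap i b (waveMap i a u) = waveMap i (a + b) u := by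
  rw [waveMap, toWV_waveMap, waveMap]
  congr 1
  cases i <;>
  · simp only [waveCurve, waveFn_of_nonpos ha, waveFn_of_nonpos hb,
      waveFn_of_nonpos (add_nonpos ha hb)]
    ext <;> simp <;> ring

lemma norm_state_le (u : State) : ‖u‖ ≤ |specVol u| + |vel u| := by
  rw [EuclideanSpace.norm_eq, Fin.sum_univ_two, Real.norm_eq_abs, Real.norm_eq_abs]
  exact Real.sqrt_le_iff.2 ⟨by positivity, by
    simp only [specVol, vel]; nlinarith [abs_nonneg (u 0), abs_nonneg (u 1)]⟩

lemma abs_specVol_le (u : State) : |specVol u| ≤ ‖u‖ := PiLp.norm_apply_le u 0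

lemma abs_vel_le (u : State) : |vel u| ≤ ‖u‖ := PiLp.norm_apply_le u 1

lemma specVol_sub (u v : State) : specVol (u - v) = specVol u - specVol v := rfl

lemma vel_sub (u v : State) : vel (u - v) = vel u - vel v := rfl

/-! ### Motion of the fronts -/

/-- From time `t₀` on, `h` moves in the direction of the family `i` (leftwards for the first family,
rightwards for the second), with a speed of at most `Λ`. -/
def Moves (Λ : ℝ) (i : Family) (t₀ : ℝ) (h : ℝ → ℝ) : Prop :=
  ∀ s t, t₀ ≤ s → s ≤ t →
    match i with
    | Family.one => h s - Λ * (t - s) ≤ h t ∧ h t ≤ h s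
    | Family.two => h s ≤ h t ∧ h t ≤ h s + Λ * (t - s)

lemma Moves.mono {Λ Λ' : ℝ} {i : Family} {t₀ t₁ : ℝ} {h : ℝ → ℝ} (hm : Moves Λ i t₀ h)
    (hΛ : Λ ≤ Λ') (ht : t₀ ≤ t₁) : Moves Λ' i t₁ h := by
  intro s t hs hst
  have := hm s t (ht.trans hs) hst
  cases i
  · exact ⟨by nlinarith [this.1], this.2⟩
  · exact ⟨this.1, by nlinarith [this.2]⟩

lemma Moves.abs_sub_le {Λ : ℝ} {i : Family} {t₀ : ℝ} {h : ℝ → ℝ} (hm : Moves Λ i t₀ h) {s t : ℝ}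
    (hs : t₀ ≤ s) (hst : s ≤ t) : |h t - h s| ≤ Λ * (t - s) := by
  have := hm s t hs hst
  rw [abs_le]
  cases i
  · simp only at this
    exact ⟨by linarith, by linarith⟩
  · simp only at this
    exact ⟨by linarith, by linarith⟩

lemma Moves.continuousOn {Λ : ℝ} {i : Family} {t₀ : ℝ} {h : ℝ → ℝ} (hm : Moves Λ i t₀ h) :
    ContinuousOn h (Ici t₀) := by
  refine (LipschitzOnWith.of_dist_le_mul (K := Λ.toNNReal) ?_).continuousOn
  intro x hx y hy
  rw [Real.dist_eq, Real.dist_eq]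
  have h1 : ∀ a b : ℝ, t₀ ≤ a → a ≤ b → |h b - h a| ≤ Λ.toNNReal * |b - a| := by
    intro a b ha hab
    rw [abs_of_nonneg (sub_nonneg.2 hab)]
    exact (hm.abs_sub_le ha hab).trans
      (mul_le_mul_of_nonneg_right (Real.le_coe_toNNReal Λ) (sub_nonneg.2 hab))
  rcases le_total x y with hxy | hxy
  · rw [abs_sub_comm, abs_sub_comm x]
    exact h1 x y hx hxy
  · exact h1 y x hy hxy

/-- By the fundamental theorem of calculus for Lipschitz functions, the a.e. bounds on the velocity
of a shock curve are bounds on its increments. -/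
lemma IsShockCurve.moves {lam : ℝ} {i : Family} {t₀ x₀ : ℝ} {h : ℝ → ℝ}
    (hc : IsShockCurve lam i t₀ x₀ h) : Moves lam i t₀ h := by
  obtain ⟨-, ⟨K, hK⟩, hd⟩ := hc
  intro s t hs hst
  have hac : AbsolutelyContinuousOnInterval h s t := by
    refine (hK.mono ?_).absolutelyContinuousOnInterval
    rw [uIcc_of_le hst]
    exact fun x hx => hs.trans hx.1
  have hint := hac.intervalIntegrable_deriv
  have hftc := hac.integral_deriv_eq_sub
  have hres : ∀ p : ℝ → Prop, (∀ᵐ x ∂(volume.restrict (Ioi t₀)), p x) →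
      ∀ᵐ x ∂(volume.restrict (Icc s t)), p x := by
    intro p hp
    rw [Measure.restrict_congr_set Ioc_ae_eq_Icc.symm]
    exact ae_restrict_of_ae_restrict_of_subset
      (show Ioc s t ⊆ Ioi t₀ from fun x hx => hs.trans_lt hx.1) hp
  have hconst : ∀ c : ℝ, IntervalIntegrable (fun _ : ℝ => c) volume s t := fun c =>
    intervalIntegrable_const
  have hlo : ∀ c : ℝ, (∀ᵐ x ∂(volume.restrict (Icc s t)), c ≤ deriv h x) →
      c * (t - s) ≤ h t - h s := by
    intro c hc
    have := intervalIntegral.integral_mono_ae_restrict hst (hconst c) hint hc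
    rw [hftc, intervalIntegral.integral_const, smul_eq_mul] at this
    linarith
  have hhi : ∀ c : ℝ, (∀ᵐ x ∂(volume.restrict (Icc s t)), deriv h x ≤ c) →
      h t - h s ≤ c * (t - s) := by
    intro c hc
    have := intervalIntegral.integral_mono_ae_restrict hst hint (hconst c) hc
    rw [hftc, intervalIntegral.integral_const, smul_eq_mul] at this
    linarith
  cases i
  · have h1 := hlo (-lam) ((hres _ hd).mono fun x hx => hx.1)
    have h2 := hhi 0 ((hres _ hd).mono fun x hx => hx.2.le)
    exact ⟨by linarith, by linarith⟩
  · have h1 := hlo 0 ((hres _ hd).mono fun x hx => hx.1.le)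
    have h2 := hhi lam ((hres _ hd).mono fun x hx => hx.2)
    exact ⟨by linarith, by linarith⟩

/-! ### Fronts, chains of fronts and the interaction functional -/

/-- The signed strength `σ` of a front, recovered from the jump of `w` across it; it is positive for
shocks and negative for rarefactions. -/
def strength (f : Front) : ℝ :=
  match f.family with
  | Family.one => (toWV f.right).1 - (toWV f.left).1
  | Family.two => (toWV f.left).1 - (toWV f.right).1

lemma strength_eq {f : Front} {σ : ℝ} (h : f.right = waveMap f.family σ f.left) :
    strength f = σ := by
  unfold strength
  rw [h, toWV_waveMap]
  cases f.family <;> simp [waveCurve]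

/-- The interaction functional: the sum of the weights of the strengths. -/
def potential (ξ : ℝ) (F : List Front) : ℝ := (F.map fun f => weight ξ (strength f)).sum

@[simp] lemma potential_nil (ξ : ℝ) : potential ξ [] = 0 := rfl

@[simp] lemma potential_cons (ξ : ℝ) (f : Front) (F : List Front) :
    potential ξ (f :: F) = weight ξ (strength f) + potential ξ F := by
  simp [potential]

@[simp] lemma potential_append (ξ : ℝ) (F G : List Front) :
    potential ξ (F ++ G) = potential ξ F + potential ξ G := by
  simp [potential]

lemma potential_nonneg {ξ : ℝ} (hξ : 1 ≤ ξ) (F : List Front) : 0 ≤ potential ξ F := by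
  induction F with
  | nil => simp
  | cons f F ih => rw [potential_cons]; exact add_nonneg (weight_nonneg hξ) ih

lemma weight_le_potential {ξ : ℝ} (hξ : 1 ≤ ξ) {F : List Front} {f : Front} (hf : f ∈ F) :
    weight ξ (strength f) ≤ potential ξ F := by
  obtain ⟨A, B, rfl⟩ := List.append_of_mem hf
  rw [potential_append, potential_cons]
  linarith [potential_nonneg hξ A, potential_nonneg hξ B]

/-- The fronts of `F`, from left to right, lead from the state `u` to the state `v`. -/
def Joins : State → List Front → State → Prop
  | u, [], v => u = v
  | u, f :: F, v => f.left = u ∧ Joins f.right F v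

@[simp] lemma joins_nil {u v : State} : Joins u [] v ↔ u = v := Iff.rfl

@[simp] lemma joins_cons {u v : State} {f : Front} {F : List Front} :
    Joins u (f :: F) v ↔ f.left = u ∧ Joins f.right F v := Iff.rfl

lemma joins_append {u v : State} {F G : List Front} :
    Joins u (F ++ G) v ↔ ∃ m, Joins u F m ∧ Joins m G v := by
  induction F generalizing u with
  | nil => simp
  | cons f F ih => simp [ih, and_assoc]

/-- A sequence of fronts that separate the successive values of `s` is a chain. -/
lemma joins_of_getElem? {F : List Front} {s : ℕ → State}
    (h : ∀ l f, F[l]? = some f → f.left = s l ∧ f.right = s (l + 1)) :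
    Joins (s 0) F (s F.length) := by
  induction F generalizing s with
  | nil => simp
  | cons f F ih =>
    have h0 := h 0 f rfl
    refine ⟨h0.1, ?_⟩
    rw [h0.2]
    exact ih (s := fun l => s (l + 1)) fun l g hg => h (l + 1) g (by simpa using hg)

/-- What is used of a front of the scheme from time `t₀` on: it joins states of positive specific
volume along a wave curve; it is a shock moving with a speed of at most `lam` or a rarefaction of
strength at most `δ` moving with constant speed. -/
structure IsValid (lam δ t₀ : ℝ) (f : Front) : Prop where
  specVol_left : 0 < specVol f.left
  right_eq : f.right = waveMap f.family (strength f) f.left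
  strength_ne_zero : strength f ≠ 0
  neg_le_strength : -δ ≤ strength f
  shock : 0 < strength f → Moves lam f.family t₀ f.path
  rarefaction : strength f < 0 → ∃ x, ∃ s ∈ Ioc (charSpeed f.family f.left)
    (charSpeed f.family f.right), ∀ t, f.path t = x + t * s

namespace IsValid

variable {lam δ t₀ : ℝ} {f : Front}

lemma specVol_right (hf : IsValid lam δ t₀ f) : 0 < specVol f.right := by
  rw [hf.right_eq]; exact specVol_waveMap_pos _ _ _

lemma mono_time {t₁ : ℝ} (hf : IsValid lam δ t₀ f) (h : t₀ ≤ t₁) : IsValid lam δ t₁ f :=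
  ⟨hf.1, hf.2, hf.3, hf.4, fun hs => (hf.shock hs).mono le_rfl h, hf.6⟩

/-- A bound for the speed of a front in terms of the specific volumes on its two sides. -/
lemma moves {Λ : ℝ} (hf : IsValid lam δ t₀ f) (h : lam ≤ Λ) (hl : 1 / specVol f.left ≤ Λ)
    (hr : 1 / specVol f.right ≤ Λ) : Moves Λ f.family t₀ f.path := by
  rcases lt_or_gt_of_ne hf.strength_ne_zero with hs | hs
  · obtain ⟨x, c, hc, hp⟩ := hf.rarefaction hs
    intro s t _ hst
    rw [hp, hp]
    have h1 : 0 < 1 / specVol f.left := one_div_pos.2 hf.specVol_left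
    have h2 : 0 < 1 / specVol f.right := one_div_pos.2 hf.specVol_right
    cases hfam : f.family
    · rw [hfam] at hc
      simp only [charSpeed, mem_Ioc] at hc
      exact ⟨by nlinarith, by nlinarith⟩
    · rw [hfam] at hc
      simp only [charSpeed, mem_Ioc] at hc
      exact ⟨by nlinarith, by nlinarith⟩
  · exact (hf.shock hs).mono h le_rfl

lemma exists_moves (hf : IsValid lam δ t₀ f) : ∃ Λ, Moves Λ f.family t₀ f.path :=
  ⟨max lam (max (1 / specVol f.left) (1 / specVol f.right)), hf.moves (le_max_left _ _)
    ((le_max_left _ _).trans (le_max_right _ _)) ((le_max_right _ _).trans (le_max_right _ _))⟩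

lemma continuousOn (hf : IsValid lam δ t₀ f) : ContinuousOn f.path (Ici t₀) :=
  hf.exists_moves.choose_spec.continuousOn

end IsValid

/-! ### The approximate Riemann solver -/

/-- The properties of the fronts of a single wave. -/
lemma IsWave.spec {ε lam δ : ℝ} (hδ : 0 < δ) {incoming : List Front} {t₀ x₀ : ℝ} {i : Family}
    {u : State} {σ : ℝ} {F : List Front} (hu : 0 < specVol u)
    (hF : IsWave ε lam δ incoming t₀ x₀ i u σ F) (ξ : ℝ) :
    Joins u F (waveMap i σ u) ∧
    (∀ f ∈ F, IsValid lam δ t₀ f ∧ f.family = i ∧ f.path t₀ = x₀) ∧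
    potential ξ F = weight ξ σ ∧ (-δ ≤ σ → F.length ≤ 1) := by
  obtain ⟨h0, hp, hn⟩ := hF
  rcases lt_trichotomy σ 0 with hσ | hσ | hσ
  · obtain ⟨hlen, hF⟩ := hn hσ
    set p := ⌈|σ| / δ⌉₊ with hpdef
    have hppos : 0 < p := Nat.ceil_pos.2 (div_pos (abs_pos.2 hσ.ne) hδ)
    have hpR : (0 : ℝ) < p := Nat.cast_pos.2 hppos
    have hsmall : -δ ≤ σ / p := by
      have : |σ| / δ ≤ p := Nat.le_ceil _
      rw [div_le_iff₀ hδ, abs_of_neg hσ] at this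
      rw [le_div_iff₀ hpR]
      linarith
    have hstep : σ / p < 0 := div_neg_of_neg_of_pos hσ hpR
    have key : ∀ f ∈ F, strength f = σ / p ∧ IsValid lam δ t₀ f ∧ f.family = i ∧
        f.path t₀ = x₀ := by
      intro f hf
      obtain ⟨l, hl⟩ := List.getElem?_of_mem hf
      obtain ⟨hfam, -, hleft, hright, s, hs, hpath⟩ := hF l f hl
      have hr : f.right = waveMap f.family (σ / p) f.left := by
        rw [hright, hleft, hfam, waveMap_add_of_nonpos _ _ hstep.le]
        · congr 1; ring
        · exact div_nonpos_of_nonpos_of_nonneg (by nlinarith [l.cast_nonneg (α := ℝ)]) hpR.le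
      have hstr := strength_eq hr
      refine ⟨hstr, ⟨?_, ?_, ?_, ?_, ?_, ?_⟩, hfam, ?_⟩
      · rw [hleft]; exact specVol_waveMap_pos _ _ _
      · rw [hstr]; exact hr
      · rw [hstr]; exact hstep.ne
      · rw [hstr]; exact hsmall
      · intro h; rw [hstr] at h; linarith
      · intro _
        exact ⟨x₀ - t₀ * s, s, by rw [hfam]; exact hs, fun t => by rw [hpath]; ring⟩
      · rw [hpath]; ring
    refine ⟨?_, fun f hf => (key f hf).2, ?_, ?_⟩
    · have := joins_of_getElem? (F := F) (s := fun l => waveMap i ((l : ℝ) * σ / p) u) (by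
        intro l f hl
        obtain ⟨-, -, hleft, hright, -⟩ := hF l f hl
        refine ⟨hleft, ?_⟩
        push_cast
        exact hright)
      simp only [Nat.cast_zero, zero_mul, zero_div] at this
      rwa [waveMap_zero i hu, hlen, mul_div_right_comm, div_self hpR.ne', one_mul] at this
    · have h1 : potential ξ F = (F.map fun _ => -(σ / p)).sum := by
        unfold potential
        congr 1
        refine List.map_congr_left fun f hf => ?_
        rw [(key f hf).1, weight_of_nonpos hstep.le]
      rw [h1, weight_of_nonpos hσ.le, List.map_const', List.sum_replicate, hlen, nsmul_eq_mul]
      field_simp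
    · intro hσδ
      rw [hlen, hpdef, Nat.ceil_le, Nat.cast_one, div_le_one hδ, abs_of_neg hσ]
      linarith
  · subst hσ
    rw [h0 rfl]
    simp [waveMap_zero i hu, weight]
  · obtain ⟨f, rfl, hfam, hleft, hright, -, hcurve⟩ := hp hσ
    have hr : f.right = waveMap f.family σ f.left := by rw [hright, hleft, hfam]
    have hstr := strength_eq hr
    refine ⟨⟨hleft, hright⟩, ?_, by simp [hstr], by simp⟩
    intro g hg
    rw [List.mem_singleton] at hg
    subst hg
    refine ⟨⟨by rwa [hleft], by rwa [hstr], by rw [hstr]; exact hσ.ne', by rw [hstr]; linarith,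
      fun _ => ?_, fun h => ?_⟩, hfam, hcurve.1⟩
    · rw [hfam]; exact hcurve.moves
    · rw [hstr] at h; linarith

/-- The properties of the fronts solving a Riemann problem: the strengths of the two waves solve the
equations of the wave curves in the `(w, v)`-plane. -/
lemma IsRiemannFan.spec {ε lam δ : ℝ} (hδ : 0 < δ) {incoming : List Front} {t₀ x₀ : ℝ}
    {ul ur : State} {G : List Front} (hu : 0 < specVol ul)
    (hG : IsRiemannFan ε lam δ incoming t₀ x₀ ul ur G) (ξ : ℝ) :
    ∃ (σ₁ σ₂ : ℝ) (F₁ F₂ : List Front), G = F₁ ++ F₂ ∧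
      σ₁ - σ₂ = (toWV ur).1 - (toWV ul).1 ∧
      waveFn σ₁ + waveFn σ₂ = (toWV ul).2 - (toWV ur).2 ∧
      Joins ul G ur ∧ (∀ f ∈ G, IsValid lam δ t₀ f ∧ f.path t₀ = x₀) ∧
      potential ξ G = weight ξ σ₁ + weight ξ σ₂ ∧
      (∀ f ∈ F₁, f.family = Family.one) ∧ (∀ f ∈ F₂, f.family = Family.two) ∧
      (-δ ≤ σ₁ → F₁.length ≤ 1) ∧ (-δ ≤ σ₂ → F₂.length ≤ 1) := by
  obtain ⟨σ₁, σ₂, F₁, F₂, hur, h1, h2, rfl⟩ := hG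
  obtain ⟨j1, v1, p1, l1⟩ := h1.spec hδ hu ξ
  obtain ⟨j2, v2, p2, l2⟩ := h2.spec hδ (specVol_waveMap_pos _ _ _) ξ
  refine ⟨σ₁, σ₂, F₁, F₂, rfl, ?_, ?_, ?_, ?_, ?_, fun f hf => (v1 f hf).2.1,
    fun f hf => (v2 f hf).2.1, l1, l2⟩
  · rw [hur]; simp only [toWV_waveMap, waveCurve]; ring
  · rw [hur]; simp only [toWV_waveMap, waveCurve]; ring
  · rw [joins_append, hur]; exact ⟨_, j1, j2⟩
  · intro f hf
    rcases List.mem_append.1 hf with hf | hf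
    · exact ⟨(v1 f hf).1, (v1 f hf).2.2⟩
    · exact ⟨(v2 f hf).1, (v2 f hf).2.2⟩
  · rw [potential_append, p1, p2]

/-! ### Interactions of two fronts -/

lemma IsValid.toWV_right {lam δ t₀ : ℝ} {f : Front} (hf : IsValid lam δ t₀ f) :
    toWV f.right = waveCurve f.family (strength f) (toWV f.left) := by
  conv_lhs => rw [hf.right_eq]
  exact toWV_waveMap _ _ _

/-- A `1`-front on the left and a `2`-front on the right do not collide: they move apart. -/
lemma not_one_two_collision {lam δ t₀ t : ℝ} {f g : Front} (hf : IsValid lam δ t₀ f)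
    (hg : IsValid lam δ t₀ g) (ht : t₀ < t) (hsep : ∀ s ∈ Ioo t₀ t, f.path s < g.path s)
    (hcoll : f.path t = g.path t) : ¬ (f.family = Family.one ∧ g.family = Family.two) := by
  rintro ⟨h1, h2⟩
  obtain ⟨s, hs⟩ := exists_between ht
  obtain ⟨Λ, hfm⟩ := hf.exists_moves
  obtain ⟨Λ', hgm⟩ := hg.exists_moves
  rw [h1] at hfm
  rw [h2] at hgm
  have h3 := (hfm s t hs.1.le hs.2.le).2
  have h4 := (hgm s t hs.1.le hs.2.le).1
  have := hsep s hs
  linarith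

/-- Two adjacent rarefaction fronts of the same family do not collide: the state between them
separates their speeds. -/
lemma not_rarefaction_collision {lam δ t₀ t : ℝ} {f g : Front} (hf : IsValid lam δ t₀ f)
    (hg : IsValid lam δ t₀ g) (hfg : g.left = f.right) (ht : t₀ < t)
    (hsep : ∀ s ∈ Ioo t₀ t, f.path s < g.path s) (hcoll : f.path t = g.path t)
    (hfam : f.family = g.family) : 0 < strength f ∨ 0 < strength g := by
  by_contra! h
  obtain ⟨x, c, hc, hp⟩ := hf.rarefaction (h.1.lt_of_ne hf.strength_ne_zero)
  obtain ⟨y, d, hd, hq⟩ := hg.rarefaction (h.2.lt_of_ne hg.strength_ne_zero)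
  obtain ⟨s, hs⟩ := exists_between ht
  have h1 := hsep s hs
  rw [hp, hq] at h1 hcoll
  rw [hfg, ← hfam] at hd
  have h2 : c < d := hc.2.trans_lt hd.1
  nlinarith [hs.2]

/-- The list `G` is made of at most two fronts, and if there are two of them, they are a `1`-front
followed by a `2`-front. -/
def IsSmallFan (G : List Front) : Prop :=
  G.length ≤ 2 ∧
    (G.length = 2 → ∃ h₁ h₂, G = [h₁, h₂] ∧ h₁.family = Family.one ∧ h₂.family = Family.two)

lemma isSmallFan_append {F₁ F₂ : List Front} (h₁ : ∀ f ∈ F₁, f.family = Family.one)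
    (h₂ : ∀ f ∈ F₂, f.family = Family.two) (l₁ : F₁.length ≤ 1) (l₂ : F₂.length ≤ 1) :
    IsSmallFan (F₁ ++ F₂) := by
  refine ⟨by simp; omega, fun h => ?_⟩
  rw [List.length_append] at h
  obtain ⟨f, rfl⟩ := List.length_eq_one_iff.1 (show F₁.length = 1 by omega)
  obtain ⟨g, rfl⟩ := List.length_eq_one_iff.1 (show F₂.length = 1 by omega)
  exact ⟨f, g, rfl, h₁ f (by simp), h₂ g (by simp)⟩

/-- The interaction of two adjacent fronts: the functional does not increase, and it decreases by a
fixed amount unless the outgoing fan consists of at most one front of each family. -/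
lemma collision_estimate {ε lam δ R t₀ t : ℝ} (hδ : 0 < δ) {f g : Front}
    {incoming G : List Front} (hf : IsValid lam δ t₀ f)
    (hg : IsValid lam δ t₀ g) (hfg : g.left = f.right) (ht : t₀ < t)
    (hfR : strength f ≤ 2 * R) (hgR : strength g ≤ 2 * R)
    (hsep : ∀ s ∈ Ioo t₀ t, f.path s < g.path s) (hcoll : f.path t = g.path t)
    (hG : IsRiemannFan ε lam δ incoming t (f.path t) f.left g.right G) :
    Joins f.left G g.right ∧ (∀ h ∈ G, IsValid lam δ t h ∧ h.path t = f.path t) ∧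
    potential (1 + 1 / Real.cosh R) G ≤
      weight (1 + 1 / Real.cosh R) (strength f) + weight (1 + 1 / Real.cosh R) (strength g) ∧
    (IsSmallFan G ∨ potential (1 + 1 / Real.cosh R) G + δ / Real.cosh R ≤
      weight (1 + 1 / Real.cosh R) (strength f) + weight (1 + 1 / Real.cosh R) (strength g)) := by
  obtain ⟨σ₁, σ₂, F₁, F₂, rfl, e1, e2, hJ, hV, hpot, k1, k2, l1, l2⟩ :=
    hG.spec hδ hf.specVol_left (1 + 1 / Real.cosh R)
  refine ⟨hJ, hV, ?_⟩
  rw [hpot]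
  rw [hg.toWV_right, hfg, hf.toWV_right] at e1 e2
  have hno := not_one_two_collision hf hg ht hsep hcoll
  have hra := not_rarefaction_collision hf hg hfg ht hsep hcoll
  have hfδ := hf.neg_le_strength
  have hgδ := hg.neg_le_strength
  have hf0 := hf.strength_ne_zero
  have hg0 := hg.strength_ne_zero
  cases hff : f.family <;> cases hgf : g.family <;> rw [hff, hgf] at e1 e2 <;>
    simp only [waveCurve] at e1 e2
  · -- two `1`-fronts: the second outgoing wave is the reflected one
    obtain ⟨s1, s2, s3⟩ := same_family_estimate (t := σ₁) (r := σ₂) hf0 hg0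
      (hra (hff.trans hgf.symm)) hfδ hgδ hδ hfR hgR (by linarith) (by linarith)
    refine ⟨s2, s3.imp_left fun s3 => ?_⟩
    exact isSmallFan_append k1 k2 (l1 s1) (l2 s3)
  · exact absurd ⟨hff, hgf⟩ hno
  · -- a `2`-front crosses a `1`-front: both keep their strengths
    obtain ⟨rfl, rfl⟩ := strengths_unique (a := σ₁) (b := σ₂) (c := strength g)
      (d := strength f) (by linarith) (by linarith)
    exact ⟨by linarith, Or.inl (isSmallFan_append k1 k2 (l1 hgδ) (l2 hfδ))⟩
  · -- two `2`-fronts: the first outgoing wave is the reflected one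
    obtain ⟨s1, s2, s3⟩ := same_family_estimate (t := σ₂) (r := σ₁) hf0 hg0
      (hra (hff.trans hgf.symm)) hfδ hgδ hδ hfR hgR (by linarith) (by linarith)
    refine ⟨by linarith, ?_⟩
    rcases s3 with s3 | s3
    · exact Or.inl (isSmallFan_append k1 k2 (l1 s3) (l2 s1))
    · exact Or.inr (by linarith)

/-! ### Evolution of the list of fronts -/

/-- The invariant of the scheme: the fronts present from time `t` on form a chain of valid fronts
with left end state `u`, and the interaction functional is at most `2R`. The weight of the shocks in
it, which has to be close to `1` when the fronts may be strong, is tied to `R`. -/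
structure IsPattern (lam δ R : ℝ) (u : State) (t : ℝ) (F : List Front) : Prop where
  joins : ∃ v, Joins u F v
  valid : ∀ f ∈ F, IsValid lam δ t f
  potential_le : potential (1 + 1 / Real.cosh R) F ≤ 2 * R

lemma one_le_shockWeight (R : ℝ) : 1 ≤ 1 + 1 / Real.cosh R := by
  have := Real.cosh_pos R
  have : 0 < 1 / Real.cosh R := by positivity
  linarith

lemma shockWeight_le_two (R : ℝ) : 1 + 1 / Real.cosh R ≤ 2 := by
  have : 1 / Real.cosh R ≤ 1 := by
    rw [div_le_one (Real.cosh_pos R)]; exact Real.one_le_cosh R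
  linarith

/-- One interaction. -/
lemma IsPattern.interaction {ε lam δ R t₀ t : ℝ} (hδ : 0 < δ) {u : State} {F F' : List Front}
    (hF : IsPattern lam δ R u t₀ F) (ht : t₀ < t) (hsep : ∀ s ∈ Ioo t₀ t, Separated F s)
    (hI : IsInteraction ε lam δ t F F') :
    ∃ (A B G : List Front) (f g : Front), F = A ++ f :: g :: B ∧ F' = A ++ (G ++ B) ∧
      f.path t = g.path t ∧ (∀ h ∈ G, h.path t = f.path t) ∧
      g.left = f.right ∧ Joins f.left G g.right ∧ IsPattern lam δ R u t F' ∧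
      potential (1 + 1 / Real.cosh R) F' ≤ potential (1 + 1 / Real.cosh R) F ∧
      (IsSmallFan G ∨ potential (1 + 1 / Real.cosh R) F' + δ / Real.cosh R ≤
        potential (1 + 1 / Real.cosh R) F) := by
  obtain ⟨A, B, G, f, g, rfl, rfl, hcoll, -, hG⟩ := hI
  have hξ := one_le_shockWeight R
  obtain ⟨⟨v, hJ⟩, hV, hpot⟩ := hF
  have hstr : ∀ h ∈ A ++ f :: g :: B, strength h ≤ 2 * R := fun h hh =>
    (le_abs_self _).trans ((abs_le_weight hξ).trans ((weight_le_potential hξ hh).trans hpot))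
  have hf : f ∈ A ++ f :: g :: B := by simp
  have hg : g ∈ A ++ f :: g :: B := by simp
  obtain ⟨m, hJA, hfl, hgl, hJB⟩ := joins_append.1 hJ
  obtain ⟨c1, c2, c3, c4⟩ := collision_estimate hδ (hV f hf) (hV g hg) hgl ht (hstr f hf)
    (hstr g hg) (fun s hs => by
      have := (List.pairwise_append.1 (hsep s hs)).2.1
      exact (List.pairwise_cons.1 this).1 g (by simp)) hcoll hG
  have hle : potential (1 + 1 / Real.cosh R) (A ++ (G ++ B)) ≤
      potential (1 + 1 / Real.cosh R) (A ++ f :: g :: B) := by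
    simp only [potential_append, potential_cons]
    linarith
  refine ⟨A, B, G, f, g, rfl, rfl, hcoll, fun h hh => (c2 h hh).2, hgl, c1, ⟨⟨v, ?_⟩, ?_, hle.trans hpot⟩,
    hle, c4.imp_right fun c4 => ?_⟩
  · rw [hfl] at c1
    exact joins_append.2 ⟨m, hJA, joins_append.2 ⟨_, c1, hJB⟩⟩
  · intro h hh
    simp only [List.mem_append] at hh
    rcases hh with hh | hh | hh
    · exact (hV h (by simp [hh])).mono_time ht.le
    · exact (c2 h hh).1
    · exact (hV h (by simp [hh])).mono_time ht.le
  · simp only [potential_append, potential_cons]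
    linarith

/-- The invariant holds throughout a run if it holds initially. -/
lemma FrontTracking.isPattern {ε lam δ R : ℝ} {ψ₀ : StepData} (hδ : 0 < δ)
    (P : FrontTracking ε lam δ ψ₀) (h0 : IsPattern lam δ R ψ₀.base 0 (P.fronts 0)) (k : ℕ)
    (hk : (k : ℕ∞) ≤ P.N) : IsPattern lam δ R ψ₀.base (P.time k) (P.fronts k) := by
  induction k with
  | zero => rwa [P.time_zero]
  | succ k ih =>
    have hk' : (k : ℕ∞) < P.N := lt_of_lt_of_le (by exact_mod_cast k.lt_succ_self) hk
    obtain ⟨_, _, _, _, _, _, _, _, _, _, _, h, _⟩ := (ih hk'.le).interaction hδ (P.time_lt k hk')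
      (P.separated k hk') (P.interaction k hk')
    exact h

/-! ### Bounds for the states in a chain of fronts -/

section Bounds

variable {lam δ t R : ℝ}

lemma IsValid.abs_w_sub_le {f : Front} (hf : IsValid lam δ t f) {ξ : ℝ} (hξ : 1 ≤ ξ) :
    |(toWV f.right).1 - (toWV f.left).1| ≤ weight ξ (strength f) := by
  rw [hf.toWV_right]
  refine le_trans (le_of_eq ?_) (abs_le_weight hξ)
  cases f.family <;> simp [waveCurve]

lemma IsValid.abs_v_sub_le {f : Front} (hf : IsValid lam δ t f) {ξ : ℝ} (hξ : 1 ≤ ξ)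
    (hR : strength f ≤ 2 * R) :
    |(toWV f.right).2 - (toWV f.left).2| ≤ Real.cosh R * weight ξ (strength f) := by
  rw [hf.toWV_right]
  have : |waveFn (strength f)| ≤ Real.cosh R * weight ξ (strength f) :=
    (abs_waveFn_le hR).trans (mul_le_mul_of_nonneg_left (abs_le_weight hξ) (Real.cosh_pos R).le)
  cases f.family <;> simpa [waveCurve] using this

/-- The states in a chain of fronts differ from its left end state by at most the value of the
functional, in the variable `w`, and by a multiple of it in the variable `v`. -/
lemma Joins.states_bound {ξ : ℝ} (hξ : 1 ≤ ξ) {F : List Front} {u v : State} (hJ : Joins u F v)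
    (hV : ∀ f ∈ F, IsValid lam δ t f) (hR : ∀ f ∈ F, strength f ≤ 2 * R) :
    ∀ f ∈ F, ∀ z, z = f.left ∨ z = f.right → |(toWV z).1 - (toWV u).1| ≤ potential ξ F ∧
      |(toWV z).2 - (toWV u).2| ≤ Real.cosh R * potential ξ F := by
  induction F generalizing u with
  | nil => simp
  | cons g F ih =>
    obtain ⟨rfl, hJ⟩ := hJ
    have hK := Real.cosh_pos R
    have hpot := potential_nonneg hξ F
    have hwt : 0 ≤ weight ξ (strength g) := weight_nonneg hξ
    have hgw := (hV g (by simp)).abs_w_sub_le hξ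
    have hgv := (hV g (by simp)).abs_v_sub_le hξ (hR g (by simp))
    intro f hf z hz
    rw [potential_cons, mul_add]
    have hKp := mul_nonneg hK.le hpot
    have hKw := mul_nonneg hK.le hwt
    rcases List.mem_cons.1 hf with rfl | hf
    · rcases hz with rfl | rfl
      · simp only [sub_self, abs_zero]
        exact ⟨by linarith, by linarith⟩
      · exact ⟨by linarith, by linarith⟩
    · obtain ⟨h1, h2⟩ := ih hJ (fun f hf => hV f (by simp [hf])) (fun f hf => hR f (by simp [hf]))
        f hf z hz
      exact ⟨(abs_sub_le _ (toWV g.right).1 _).trans (by linarith),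
        (abs_sub_le _ (toWV g.right).2 _).trans (by linarith)⟩

lemma IsPattern.strength_le {u : State} {F : List Front} (hF : IsPattern lam δ R u t F) {f : Front}
    (hf : f ∈ F) : strength f ≤ 2 * R :=
  (le_abs_self _).trans ((abs_le_weight (one_le_shockWeight R)).trans
    ((weight_le_potential (one_le_shockWeight R) hf).trans hF.potential_le))

lemma IsPattern.states_bound {u : State} {F : List Front} (hF : IsPattern lam δ R u t F)
    {f : Front} (hf : f ∈ F) {z : State} (hz : z = f.left ∨ z = f.right) :
    |(toWV z).1 - (toWV u).1| ≤ 2 * R ∧ |(toWV z).2 - (toWV u).2| ≤ Real.cosh R * (2 * R) := by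
  obtain ⟨v, hJ⟩ := hF.joins
  obtain ⟨h1, h2⟩ := hJ.states_bound (one_le_shockWeight R) hF.valid
    (fun f hf => hF.strength_le hf) f hf z hz
  exact ⟨h1.trans hF.potential_le, h2.trans
    (mul_le_mul_of_nonneg_left hF.potential_le (Real.cosh_pos R).le)⟩

lemma one_div_specVol_le {z : State} (hz : 0 < specVol z) {b : ℝ} (h : (toWV z).1 ≤ b) :
    1 / specVol z ≤ Real.exp b := by
  rw [one_div, ← Real.exp_log hz, ← Real.exp_neg]
  exact Real.exp_le_exp.2 h

/-- All the fronts of a pattern have a speed of at most `max lam (exp (b + 2R))`, if `b` bounds the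
variable `w` at `-∞`. -/
lemma IsPattern.moves {u : State} {F : List Front} (hF : IsPattern lam δ R u t F) {b : ℝ}
    (hb : (toWV u).1 ≤ b) {f : Front} (hf : f ∈ F) :
    Moves (max lam (Real.exp (b + 2 * R))) f.family t f.path := by
  have hv := hF.valid f hf
  have h1 := (abs_le.1 (hF.states_bound hf (Or.inl rfl)).1).2
  have h2 := (abs_le.1 (hF.states_bound hf (Or.inr rfl)).1).2
  exact hv.moves (le_max_left _ _)
    ((one_div_specVol_le hv.specVol_left (by linarith)).trans (le_max_right _ _))
    ((one_div_specVol_le hv.specVol_right (by linarith)).trans (le_max_right _ _))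

end Bounds

/-! ### The interaction times do not accumulate -/

open Filter Topology in
/-- Ordered particles `y k 0 < ⋯ < y k (n - 1)` are observed at times `s k`. Between the `k`-th and
the `(k+1)`-st time the neighbours `p k` and `p k + 1` collide; then the left one starts to move to
the left and the right one to the right, and they go on so until their next collisions. With bounded
speeds, infinitely many collisions in finite time are impossible: for a maximal block of neighbours
that collide again and again, the outermost particles eventually move apart, but all particles of
the block have the same limit position. -/
lemma no_accumulation {n : ℕ} {p : ℕ → ℕ} {goesLeft goesRight : ℕ → ℕ → Prop} {y : ℕ → ℕ → ℝ}
    {s : ℕ → ℝ} {Λ T : ℝ} (hp : ∀ k, p k + 1 < n)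
    (hL : ∀ k, goesLeft (k + 1) (p k)) (hR : ∀ k, goesRight (k + 1) (p k + 1))
    (stayL : ∀ k i, i ≠ p k → i ≠ p k + 1 → goesLeft k i → goesLeft (k + 1) i)
    (stayR : ∀ k i, i ≠ p k → i ≠ p k + 1 → goesRight k i → goesRight (k + 1) i)
    (moveL : ∀ k i, i < n → goesLeft k i → goesLeft (k + 1) i → y (k + 1) i ≤ y k i)
    (moveR : ∀ k i, i < n → goesRight k i → goesRight (k + 1) i → y k i ≤ y (k + 1) i)
    (hlt : ∀ k i j, i < j → j < n → y k i < y k j)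
    (hlip : ∀ k i, i < n → |y (k + 1) i - y k i| ≤ Λ * (s (k + 1) - s k))
    (hcoll : ∀ k, y k (p k + 1) - y k (p k) ≤ 2 * Λ * (s (k + 1) - s k))
    (hΛ : 0 ≤ Λ) (hs : Monotone s) (hsT : ∀ k, s k ≤ T) : False := by
  set S : Set ℕ := {i | ∃ᶠ k in atTop, p k = i} with hSdef
  have hSlt : ∀ i ∈ S, i + 1 < n := by
    intro i hi
    obtain ⟨k, rfl⟩ := hi.exists
    exact hp k
  have hSne : ∃ i, i ∈ S := by
    by_contra! h
    have h1 : ∀ i ∈ Finset.range n, ∀ᶠ k in atTop, p k ≠ i := fun i _ =>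
      not_frequently.1 (h i)
    obtain ⟨k, hk⟩ := ((Finset.eventually_all _).2 h1).exists
    exact hk (p k) (Finset.mem_range.2 (by have := hp k; omega)) rfl
  classical
  -- the block `[m, q]` of neighbours that collide infinitely often
  set m := Nat.find hSne with hmdef
  have hmS : m ∈ S := Nat.find_spec hSne
  have hmin : ∀ i < m, i ∉ S := fun i hi => Nat.find_min hSne hi
  have hex : ∃ q, m ≤ q ∧ q ∉ S :=
    ⟨n, by have := hSlt m hmS; omega, fun h => by have := hSlt n h; omega⟩
  set q := Nat.find hex with hqdef
  have hq : m ≤ q ∧ q ∉ S := Nat.find_spec hex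
  have hblock : ∀ i, m ≤ i → i < q → i ∈ S := by
    intro i h1 h2
    by_contra h3
    exact Nat.find_min hex h2 ⟨h1, h3⟩
  have hmq : m < q := hq.1.lt_of_ne (fun h => hq.2 (h ▸ hmS))
  obtain ⟨q', hq'⟩ : ∃ q', q = q' + 1 := ⟨q - 1, by omega⟩
  have hq'S : q' ∈ S := hblock q' (by omega) (by omega)
  have hqn : q < n := hq' ▸ hSlt q' hq'S
  have hev : ∀ᶠ k in atTop, p k + 1 ≠ m ∧ p k ≠ q := by
    refine Filter.Eventually.and ?_ (not_frequently.1 hq.2)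
    rcases Nat.eq_zero_or_pos m with h0 | h0
    · exact Eventually.of_forall fun k => by omega
    · exact (not_frequently.1 (hmin (m - 1) (by omega))).mono fun k hk => by omega
  obtain ⟨k₀, hk₀⟩ := eventually_atTop.1 hev
  have hleft : ∃ k, ∀ j ≥ k, goesLeft j m := by
    obtain ⟨k, hk, hpk⟩ := frequently_atTop.1 hmS k₀
    refine ⟨k + 1, fun j hj => ?_⟩
    induction j, hj using Nat.le_induction with
    | base => rw [← hpk]; exact hL k
    | succ j hj ih =>
      by_cases h : p j = m
      · rw [← h]; exact hL j
      · exact stayL j m (Ne.symm h) (Ne.symm (hk₀ j (by omega)).1) ih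
  have hright : ∃ k, ∀ j ≥ k, goesRight j q := by
    obtain ⟨k, hk, hpk⟩ := frequently_atTop.1 hq'S k₀
    refine ⟨k + 1, fun j hj => ?_⟩
    induction j, hj using Nat.le_induction with
    | base => rw [hq', ← hpk]; exact hR k
    | succ j hj ih =>
      by_cases h : p j + 1 = q
      · rw [← h]; exact hR j
      · exact stayR j q (Ne.symm (hk₀ j (by omega)).2) (Ne.symm h) ih
  obtain ⟨kl, hkl⟩ := hleft
  obtain ⟨kr, hkr⟩ := hright
  set k₁ := max kl kr
  have hgap : ∀ k ≥ k₁, y k₁ q - y k₁ m ≤ y k q - y k m := by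
    intro k hk
    induction k, hk using Nat.le_induction with
    | base => exact le_rfl
    | succ k hk ih =>
      have h1 := moveL k m (hmq.trans hqn) (hkl k (le_trans (le_max_left _ _) hk))
        (hkl (k + 1) (le_trans (le_max_left _ _) (hk.trans k.le_succ)))
      have h2 := moveR k q hqn (hkr k (le_trans (le_max_right _ _) hk))
        (hkr (k + 1) (le_trans (le_max_right _ _) (hk.trans k.le_succ)))
      linarith
  -- all positions converge
  have hslim : Tendsto s atTop (𝓝 (⨆ k, s k)) :=
    tendsto_atTop_ciSup hs ⟨T, by rintro _ ⟨k, rfl⟩; exact hsT k⟩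
  have hslim' : Tendsto (fun k => 2 * Λ * (s (k + 1) - s k)) atTop (𝓝 0) := by
    have := ((hslim.comp (tendsto_add_atTop_nat 1)).sub hslim).const_mul (2 * Λ)
    simpa using this
  have hlim : ∀ i, ∃ Y, i < n → Tendsto (fun k => y k i) atTop (𝓝 Y) := by
    intro i
    by_cases hi : i < n
    swap
    · exact ⟨0, fun h => absurd h hi⟩
    have hmono : Monotone fun k => y k i + Λ * s k := monotone_nat_of_le_succ fun k => by
      have := (abs_le.1 (hlip k i hi)).1
      linarith
    have hanti : Antitone fun k => y k i - Λ * s k := antitone_nat_of_succ_le fun k => by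
      have := (abs_le.1 (hlip k i hi)).2
      linarith
    have hbdd : BddAbove (range fun k => y k i + Λ * s k) := by
      refine ⟨y 0 i - Λ * s 0 + 2 * Λ * T, ?_⟩
      rintro _ ⟨k, rfl⟩
      have h1 := hanti (Nat.zero_le k)
      have h2 := mul_le_mul_of_nonneg_left (hsT k) hΛ
      simp only at h1 ⊢
      linarith
    have := (tendsto_atTop_ciSup hmono hbdd).sub (hslim.const_mul Λ)
    exact ⟨_, fun _ => by simpa using this⟩
  choose Y hY using hlim
  have hstep : ∀ i ∈ S, Y (i + 1) ≤ Y i := by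
    intro i hi
    have h1 := ((hY (i + 1) (hSlt i hi)).sub (hY i (by have := hSlt i hi; omega))).sub hslim'
    have h2 := le_of_tendsto_of_frequently h1 (b := 0) (hi.mono fun k hk => by
      have := hcoll k
      rw [hk] at this
      linarith)
    linarith
  have hle : ∀ i, m ≤ i → i ≤ q → Y i ≤ Y m := by
    intro i hi
    induction i, hi using Nat.le_induction with
    | base => exact fun _ => le_rfl
    | succ i hi ih => exact fun h => (hstep i (hblock i hi (by omega))).trans (ih (by omega))
  have h3 : y k₁ q - y k₁ m ≤ Y q - Y m :=
    ge_of_tendsto ((hY q hqn).sub (hY m (hmq.trans hqn)))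
      (eventually_atTop.2 ⟨k₁, hgap⟩)
  have h4 := hlt k₁ m q hmq hqn
  have h5 := hle q hmq.le le_rfl
  linarith

/-- A sequence of interactions in bounded time, each of which replaces two fronts by a `1`-front and
a `2`-front, cannot be infinite. The particles of `no_accumulation` are the fronts, numbered from the
left; they are observed at the midpoints between the interaction times, when they are separated. -/
lemma no_infinite_two_two_interactions {F : ℕ → List Front} {τ : ℕ → ℝ} {n : ℕ} {Λ T : ℝ}
    (hlen : ∀ k, (F k).length = n) (hτ : ∀ k, τ k < τ (k + 1)) (hT : ∀ k, τ k ≤ T) (hΛ : 0 ≤ Λ)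
    (hmove : ∀ k, ∀ f ∈ F k, Moves Λ f.family (τ k) f.path)
    (hsep : ∀ k, ∀ t ∈ Ioo (τ k) (τ (k + 1)), Separated (F k) t)
    (hint : ∀ k, ∃ (A B : List Front) (f g h₁ h₂ : Front), F k = A ++ f :: g :: B ∧
      F (k + 1) = A ++ h₁ :: h₂ :: B ∧ f.path (τ (k + 1)) = g.path (τ (k + 1)) ∧
      h₁.path (τ (k + 1)) = f.path (τ (k + 1)) ∧ h₂.path (τ (k + 1)) = f.path (τ (k + 1)) ∧
      h₁.family = Family.one ∧ h₂.family = Family.two) : False := by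
  choose A B f g h₁ h₂ e1 e2 c1 c2 c3 m1 m2 using hint
  have hget : ∀ k i, i < n → ∃ φ, (F k)[i]? = some φ := fun k i hi =>
    ⟨(F k)[i]'(by rw [hlen]; exact hi), List.getElem?_eq_getElem _⟩
  have hother : ∀ k i, i ≠ (A k).length → i ≠ (A k).length + 1 → (F (k + 1))[i]? = (F k)[i]? := by
    intro k i hi hi'
    rw [e1 k, e2 k]
    rcases lt_or_ge i (A k).length with h | h
    · rw [List.getElem?_append_left h, List.getElem?_append_left h]
    · rw [List.getElem?_append_right h, List.getElem?_append_right h]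
      obtain ⟨j, hj⟩ : ∃ j, i - (A k).length = j + 2 := ⟨i - (A k).length - 2, by omega⟩
      rw [hj]
      rfl
  have hf : ∀ k, (F k)[(A k).length]? = some (f k) := fun k => by rw [e1]; simp
  have hg : ∀ k, (F k)[(A k).length + 1]? = some (g k) := fun k => by rw [e1]; simp
  have hh₁ : ∀ k, (F (k + 1))[(A k).length]? = some (h₁ k) := fun k => by rw [e2]; simp
  have hh₂ : ∀ k, (F (k + 1))[(A k).length + 1]? = some (h₂ k) := fun k => by rw [e2]; simp
  have hpos : ∀ (k i : ℕ) (φ ψ : Front), (F k)[i]? = some φ → (F (k + 1))[i]? = some ψ →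
      φ.path (τ (k + 1)) = ψ.path (τ (k + 1)) := by
    intro k i φ ψ hφ hψ
    by_cases h : i = (A k).length
    · subst h
      rw [hf, Option.some_inj] at hφ
      rw [hh₁, Option.some_inj] at hψ
      rw [← hφ, ← hψ, c2]
    by_cases h' : i = (A k).length + 1
    · subst h'
      rw [hg, Option.some_inj] at hφ
      rw [hh₂, Option.some_inj] at hψ
      rw [← hφ, ← hψ, c3, c1]
    · rw [hother k i h h', hφ, Option.some_inj] at hψ
      rw [hψ]
  set s : ℕ → ℝ := fun k => (τ k + τ (k + 1)) / 2 with hs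
  have hs1 : ∀ k, τ k < s k := fun k => by have := hτ k; simp only [hs]; linarith
  have hs2 : ∀ k, s k < τ (k + 1) := fun k => by have := hτ k; simp only [hs]; linarith
  set y : ℕ → ℕ → ℝ := fun k i => (((F k)[i]?).map fun φ => φ.path (s k)).getD 0 with hydef
  have hy : ∀ k i φ, (F k)[i]? = some φ → y k i = φ.path (s k) := by
    intro k i φ h
    simp [hydef, h]
  have hmv : ∀ (k i : ℕ) (φ : Front), (F k)[i]? = some φ → Moves Λ φ.family (τ k) φ.path := fun k i φ h =>
    hmove k φ (List.mem_of_getElem? h)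
  refine no_accumulation (n := n) (p := fun k => (A k).length) (Λ := Λ) (T := T) (y := y) (s := s)
    (goesLeft := fun k i => ∃ φ, (F k)[i]? = some φ ∧ φ.family = Family.one)
    (goesRight := fun k i => ∃ φ, (F k)[i]? = some φ ∧ φ.family = Family.two)
    ?_ (fun k => ⟨h₁ k, hh₁ k, m1 k⟩) (fun k => ⟨h₂ k, hh₂ k, m2 k⟩) ?_ ?_ ?_ ?_ ?_ ?_ ?_ hΛ
    (monotone_nat_of_le_succ fun k => ((hs2 k).trans (hs1 (k + 1))).le)
    (fun k => (hs2 k).le.trans (hT _))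
  · intro k
    rw [← hlen k, e1 k]
    simp
  · intro k i h h' ⟨φ, hφ, hfam⟩
    exact ⟨φ, by rw [hother k i h h', hφ], hfam⟩
  · intro k i h h' ⟨φ, hφ, hfam⟩
    exact ⟨φ, by rw [hother k i h h', hφ], hfam⟩
  · intro k i _ ⟨φ, hφ, hφf⟩ ⟨ψ, hψ, hψf⟩
    have a1 := hmv k i φ hφ
    have a2 := hmv (k + 1) i ψ hψ
    rw [hφf] at a1
    rw [hψf] at a2
    have b1 := (a1 (s k) (τ (k + 1)) (hs1 k).le (hs2 k).le).2
    have b2 := (a2 (τ (k + 1)) (s (k + 1)) le_rfl (hs1 (k + 1)).le).2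
    rw [hy k i φ hφ, hy (k + 1) i ψ hψ]
    have := hpos k i φ ψ hφ hψ
    linarith
  · intro k i _ ⟨φ, hφ, hφf⟩ ⟨ψ, hψ, hψf⟩
    have a1 := hmv k i φ hφ
    have a2 := hmv (k + 1) i ψ hψ
    rw [hφf] at a1
    rw [hψf] at a2
    have b1 := (a1 (s k) (τ (k + 1)) (hs1 k).le (hs2 k).le).1
    have b2 := (a2 (τ (k + 1)) (s (k + 1)) le_rfl (hs1 (k + 1)).le).1
    rw [hy k i φ hφ, hy (k + 1) i ψ hψ]
    have := hpos k i φ ψ hφ hψ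
    linarith
  · intro k i j hij hj
    obtain ⟨φ, hφ⟩ := hget k i (hij.trans hj)
    obtain ⟨ψ, hψ⟩ := hget k j hj
    rw [hy k i φ hφ, hy k j ψ hψ]
    have := List.pairwise_iff_getElem.1 (hsep k (s k) ⟨hs1 k, hs2 k⟩) i j
      (by rw [hlen]; exact hij.trans hj) (by rw [hlen]; exact hj) hij
    rw [List.getElem?_eq_some_iff] at hφ hψ
    obtain ⟨_, rfl⟩ := hφ
    obtain ⟨_, rfl⟩ := hψ
    exact this
  · intro k i hi
    obtain ⟨φ, hφ⟩ := hget k i hi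
    obtain ⟨ψ, hψ⟩ := hget (k + 1) i hi
    rw [hy k i φ hφ, hy (k + 1) i ψ hψ]
    have b1 := (hmv k i φ hφ).abs_sub_le (hs1 k).le (hs2 k).le
    have b2 := (hmv (k + 1) i ψ hψ).abs_sub_le le_rfl (hs1 (k + 1)).le
    have := hpos k i φ ψ hφ hψ
    rw [this] at b1
    exact (abs_sub_le _ (ψ.path (τ (k + 1))) _).trans (by linarith)
  · intro k
    rw [hy k _ _ (hf k), hy k _ _ (hg k)]
    have b1 := (hmv k _ _ (hf k)).abs_sub_le (hs1 k).le (hs2 k).le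
    have b2 := (hmv k _ _ (hg k)).abs_sub_le (hs1 k).le (hs2 k).le
    have := c1 k
    rw [abs_le] at b1 b2
    have h3 : Λ * (τ (k + 1) - s k) ≤ Λ * (s (k + 1) - s k) :=
      mul_le_mul_of_nonneg_left (by linarith [hs1 (k + 1)]) hΛ
    linarith [b1.1, b1.2, b2.1, b2.2]

lemma exists_eventually_const {a : ℕ → ℕ} (ha : Antitone a) : ∃ k₀, ∀ k ≥ k₀, a k = a k₀ :=
  ⟨Function.argmin a, fun _ hk => le_antisymm (ha hk) (Function.argmin_le a _)⟩

/-- Interaction times do not accumulate. Each interaction whose outgoing fan is not small uses up a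
fixed amount of the functional, so there are finitely many of them; afterwards the number of fronts
does not increase, hence is eventually constant, and then each interaction replaces two fronts by a
`1`-front and a `2`-front. -/
lemma FrontTracking.not_bounded {ε lam δ R : ℝ} {ψ₀ : StepData} (hlam : 0 ≤ lam) (hδ : 0 < δ)
    (P : FrontTracking ε lam δ ψ₀) (h0 : IsPattern lam δ R ψ₀.base 0 (P.fronts 0)) (hN : P.N = ⊤)
    {T : ℝ} (hT : ∀ k, P.time k ≤ T) : False := by
  have hlt : ∀ k : ℕ, (k : ℕ∞) < P.N := fun k => by rw [hN]; exact ENat.natCast_lt_top k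
  have hpat : ∀ k, IsPattern lam δ R ψ₀.base (P.time k) (P.fronts k) := fun k =>
    P.isPattern hδ h0 k (hlt k).le
  have hstep := fun k => (hpat k).interaction hδ (P.time_lt k (hlt k))
    (P.separated k (hlt k)) (P.interaction k (hlt k))
  choose A B G f g e1 e2 c1 c2 _ _ _ hmono hdrop using hstep
  set Q : ℕ → ℝ := fun k => potential (1 + 1 / Real.cosh R) (P.fronts k) with hQ
  have hc : 0 < δ / Real.cosh R := div_pos hδ (Real.cosh_pos R)
  have hQanti : Antitone fun k => ⌊Q k / (δ / Real.cosh R)⌋₊ := antitone_nat_of_succ_le fun k =>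
    Nat.floor_le_floor (div_le_div_of_nonneg_right (hmono k) hc.le)
  obtain ⟨k₀, hk₀⟩ := exists_eventually_const hQanti
  have hsmall : ∀ k ≥ k₀, IsSmallFan (G k) := by
    intro k hk
    refine (hdrop k).resolve_right fun h => ?_
    have h1 : ⌊Q (k + 1) / (δ / Real.cosh R) + 1⌋₊ ≤ ⌊Q k / (δ / Real.cosh R)⌋₊ := by
      refine Nat.floor_le_floor ?_
      rw [le_div_iff₀ hc, add_mul, div_mul_cancel₀ _ hc.ne', one_mul]
      exact h
    have h0 : 0 ≤ Q (k + 1) / (δ / Real.cosh R) :=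
      div_nonneg (potential_nonneg (one_le_shockWeight R) _) hc.le
    rw [Nat.floor_add_one h0] at h1
    have h2 : ⌊Q k / (δ / Real.cosh R)⌋₊ = ⌊Q k₀ / (δ / Real.cosh R)⌋₊ := hk₀ k hk
    have h3 : ⌊Q (k + 1) / (δ / Real.cosh R)⌋₊ = ⌊Q k₀ / (δ / Real.cosh R)⌋₊ :=
      hk₀ (k + 1) (by omega)
    omega
  have hlen : ∀ k, (P.fronts (k + 1)).length + 2 = (P.fronts k).length + (G k).length := by
    intro k
    rw [e1 k, e2 k]
    simp
    omega
  have hlanti : Antitone fun k => (P.fronts (k₀ + k)).length := antitone_nat_of_succ_le fun k => by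
    have := hlen (k₀ + k)
    have := (hsmall (k₀ + k) (by omega)).1
    rw [← add_assoc]
    omega
  obtain ⟨k₁, hk₁⟩ := exists_eventually_const hlanti
  set K := k₀ + k₁
  have hlenK : ∀ k, (P.fronts (K + k)).length = (P.fronts K).length := fun k => by
    rw [add_assoc k₀ k₁ k]
    exact hk₁ (k₁ + k) (by omega)
  refine no_infinite_two_two_interactions (F := fun k => P.fronts (K + k))
    (τ := fun k => P.time (K + k)) (T := T)
    (Λ := max lam (Real.exp ((toWV ψ₀.base).1 + 2 * R))) hlenK
    (fun k => P.time_lt _ (hlt _)) (fun k => hT _) (hlam.trans (le_max_left _ _))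
    (fun k φ hφ => (hpat _).moves le_rfl hφ) (fun k => P.separated _ (hlt _)) fun k => ?_
  have h2 : (G (K + k)).length = 2 := by
    have h1 := hlen (K + k)
    have h3 := hlenK k
    have h4 := hlenK (k + 1)
    rw [← add_assoc] at h4
    omega
  obtain ⟨h₁, h₂, hG, f1, f2⟩ := (hsmall (K + k) (by omega)).2 h2
  have hG' := c2 (K + k)
  rw [hG] at hG'
  refine ⟨A (K + k), B (K + k), f (K + k), g (K + k), h₁, h₂, e1 _, ?_, c1 _,
    hG' h₁ (by simp), hG' h₂ (by simp), f1, f2⟩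
  have := e2 (K + k)
  rw [hG] at this
  exact this

lemma FrontTracking.interactions_finite {ε lam δ R : ℝ} {ψ₀ : StepData} (hlam : 0 ≤ lam)
    (hδ : 0 < δ) (P : FrontTracking ε lam δ ψ₀)
    (h0 : IsPattern lam δ R ψ₀.base 0 (P.fronts 0)) (T : ℝ) : (P.interactions T).Finite := by
  by_contra hinf
  have hN : P.N = ⊤ := by
    by_contra hN
    obtain ⟨N, hN⟩ := ENat.ne_top_iff_exists.1 hN
    refine hinf ((Set.finite_Iic N).subset fun k hk => ?_)
    have := hk.2.1
    rw [← hN] at this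
    exact_mod_cast this
  have hmono : Monotone P.time := monotone_nat_of_le_succ fun k =>
    (P.time_lt k (by rw [hN]; exact ENat.natCast_lt_top k)).le
  refine P.not_bounded hlam hδ h0 hN (T := T) fun k => ?_
  obtain ⟨j, hj, hkj⟩ := Set.Infinite.exists_gt hinf k
  exact (hmono hkj.le).trans hj.2.2

/-- Every time `t ≥ 0` is reached by the run. -/
lemma FrontTracking.exists_isStage {ε lam δ R : ℝ} {ψ₀ : StepData} (hlam : 0 ≤ lam) (hδ : 0 < δ)
    (P : FrontTracking ε lam δ ψ₀) (h0 : IsPattern lam δ R ψ₀.base 0 (P.fronts 0)) {t : ℝ}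
    (ht : 0 ≤ t) : ∃ k, P.IsStage t k := by
  have hfin : {k : ℕ | (k : ℕ∞) ≤ P.N ∧ P.time k ≤ t}.Finite := by
    refine ((P.interactions_finite hlam hδ h0 t).insert 0).subset fun k hk => ?_
    rcases Nat.eq_zero_or_pos k with h | h
    · exact Or.inl h
    · exact Or.inr ⟨h, hk⟩
  obtain ⟨k, hk, hmax⟩ := hfin.exists_maximal ⟨0, by simp, by rw [P.time_zero]; exact ht⟩
  refine ⟨k, hk.1, hk.2, fun hkN => ?_⟩
  by_contra! h
  have := hmax (y := k + 1) ⟨by push_cast; exact Order.add_one_le_of_lt hkN, h⟩ (Nat.le_succ k)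
  omega

/-! ### The piecewise constant function described by a chain of fronts -/

/-- The function with value `u` near `-∞` and with the jumps of the fronts `F` at their positions at
time `t`. For a chain of ordered fronts, these are the values of the front tracking approximation;
written as a sum it does not depend on the order of fronts at the same position. -/
def profile (u : State) (F : List Front) (t x : ℝ) : State :=
  u + (F.map fun f => if f.path t ≤ x then f.right - f.left else 0).sum

/-- The sum of the sizes of the jumps. -/
def totalJump (F : List Front) : ℝ := (F.map fun f => ‖f.right - f.left‖).sum

lemma totalJump_nonneg (F : List Front) : 0 ≤ totalJump F :=
  List.sum_nonneg (by simp only [List.mem_map]; rintro _ ⟨f, -, rfl⟩; exact norm_nonneg _)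

lemma foldl_eq_self_of_lt {F : List Front} {t x : ℝ} (h : ∀ g ∈ F, ¬ g.path t ≤ x) (u : State) :
    F.foldl (fun u f => if f.path t ≤ x then f.right else u) u = u := by
  induction F with
  | nil => rfl
  | cons g F ih =>
    rw [List.foldl_cons, if_neg (h g (by simp))]
    exact ih fun g hg => h g (by simp [hg])

lemma foldl_eq_profile {u v : State} {F : List Front} {t : ℝ} (hJ : Joins u F v)
    (hF : F.Pairwise fun f g => f.path t ≤ g.path t) (x : ℝ) :
    F.foldl (fun u f => if f.path t ≤ x then f.right else u) u = profile u F t x := by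
  induction F generalizing u with
  | nil => simp [profile]
  | cons f F ih =>
    obtain ⟨rfl, hJ⟩ := hJ
    obtain ⟨h1, h2⟩ := List.pairwise_cons.1 hF
    have ih := ih hJ h2
    rw [List.foldl_cons]
    by_cases hx : f.path t ≤ x
    · rw [if_pos hx, ih]
      simp only [profile, List.map_cons, List.sum_cons, if_pos hx]
      abel
    · rw [if_neg hx]
      have h3 : ∀ g ∈ F, ¬ g.path t ≤ x := fun g hg h => hx ((h1 g hg).trans h)
      have h5 : (F.map fun f => if f.path t ≤ x then f.right - f.left else 0).sum = (0 : State) := by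
        refine List.sum_eq_zero fun z hz => ?_
        obtain ⟨g, hg, rfl⟩ := List.mem_map.1 hz
        exact if_neg (h3 g hg)
      rw [foldl_eq_self_of_lt h3]
      simp [profile, hx, h5]

lemma sum_map_ite_of_joins {u v : State} {G : List Front} {t a x : ℝ} (hJ : Joins u G v)
    (hG : ∀ h ∈ G, h.path t = a) :
    (G.map fun f => if f.path t ≤ x then f.right - f.left else 0).sum =
      if a ≤ x then v - u else 0 := by
  induction G generalizing u with
  | nil => obtain rfl : u = v := hJ; simp
  | cons g G ih =>
    obtain ⟨rfl, hJ⟩ := hJ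
    rw [List.map_cons, List.sum_cons, ih hJ fun h hh => hG h (by simp [hh]), hG g (by simp)]
    split_ifs <;> simp

/-- The profile does not change when a fan is replaced by another one at the same point. -/
lemma profile_congr {u : State} {A B G : List Front} {f g : Front} {t : ℝ}
    (hcoll : f.path t = g.path t) (hG : ∀ h ∈ G, h.path t = f.path t) (hfg : g.left = f.right)
    (hJ : Joins f.left G g.right) :
    profile u (A ++ f :: g :: B) t = profile u (A ++ (G ++ B)) t := by
  funext x
  have h1 := sum_map_ite_of_joins (x := x) (t := t) (G := [f, g]) (a := f.path t)
    (show Joins f.left [f, g] g.right from ⟨rfl, hfg, rfl⟩)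
    (by simp [hcoll])
  have h2 := sum_map_ite_of_joins (x := x) hJ hG
  rw [← h2] at h1
  simp only [List.map_cons, List.map_nil, List.sum_cons, List.sum_nil, add_zero] at h1
  simp only [profile, List.map_append, List.sum_append, List.map_cons, List.sum_cons]
  rw [← h1]
  simp only [add_assoc]

/-! ### Total variation and `L¹` distance of profiles -/

lemma eVariationOn_add_le {f g : ℝ → State} {s : Set ℝ} :
    eVariationOn (fun x => f x + g x) s ≤ eVariationOn f s + eVariationOn g s := by
  refine iSup_le fun p => ?_
  refine (Finset.sum_le_sum fun i _ => edist_add_add_le (f (p.2.1 (i + 1))) (g (p.2.1 (i + 1)))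
    (f (p.2.1 i)) (g (p.2.1 i))).trans ?_
  rw [Finset.sum_add_distrib]
  exact add_le_add (eVariationOn.sum_le p.2.2.1 p.2.2.2)
    (eVariationOn.sum_le p.2.2.1 p.2.2.2)

lemma eVariationOn_step_le (a : ℝ) (c : State) :
    eVariationOn (fun x => if a ≤ x then c else 0) univ ≤ ‖c‖ₑ := by
  have h := eVariationOn.comp_le_of_monotoneOn (fun b : Bool => if b then c else 0)
    (s := univ) (t := univ) (fun x : ℝ => decide (a ≤ x))
    (fun x _ y _ hxy => by
      simp only [Bool.le_iff_imp, decide_eq_true_eq]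
      exact fun h => h.trans hxy) (fun _ _ => mem_univ _)
  have h2 : (univ : Set Bool) = {true, false} := by ext b; cases b <;> simp
  rw [h2, eVariationOn.pair] at h
  simpa [Function.comp_def, edist_zero_right] using h

lemma eVariationOn_profile_le (u : State) (F : List Front) (t : ℝ) :
    eVariationOn (profile u F t) univ ≤ ENNReal.ofReal (totalJump F) := by
  induction F generalizing u with
  | nil =>
    refine (eVariationOn.constant_on ?_).le.trans zero_le
    rintro _ ⟨x, -, rfl⟩ _ ⟨y, -, rfl⟩
    simp [profile]
  | cons f F ih =>
    have h1 : profile u (f :: F) t = fun x =>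
        (if f.path t ≤ x then f.right - f.left else 0) + profile u F t x := by
      funext x
      simp only [profile, List.map_cons, List.sum_cons]
      abel
    have h2 : totalJump (f :: F) = ‖f.right - f.left‖ + totalJump F := by simp [totalJump]
    rw [h1, h2, ENNReal.ofReal_add (norm_nonneg _) (totalJump_nonneg F), ofReal_norm]
    exact eVariationOn_add_le.trans (add_le_add (eVariationOn_step_le _ _) (ih u))

lemma measurable_profile (u : State) (F : List Front) (t : ℝ) : Measurable (profile u F t) := by
  induction F with
  | nil =>
    have h1 : profile u [] t = fun _ => u := by funext x; simp [profile]
    rw [h1]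
    exact measurable_const
  | cons f F ih =>
    have h1 : profile u (f :: F) t = fun x =>
        (if f.path t ≤ x then f.right - f.left else 0) + profile u F t x := by
      funext x
      simp only [profile, List.map_cons, List.sum_cons]
      abel
    rw [h1]
    exact (Measurable.ite measurableSet_Ici measurable_const measurable_const).add ih

lemma lintegral_step_sub_le (a b : ℝ) (c : State) :
    ∫⁻ x, ‖(if a ≤ x then c else 0) - (if b ≤ x then c else 0)‖ₑ ∂volume ≤
      ‖c‖ₑ * ENNReal.ofReal |a - b| := by
  have h : ∀ x, ‖(if a ≤ x then c else 0) - (if b ≤ x then c else 0)‖ₑ ≤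
      (Ico (min a b) (max a b)).indicator (fun _ => ‖c‖ₑ) x := by
    intro x
    by_cases ha : a ≤ x <;> by_cases hb : b ≤ x
    · simp [ha, hb]
    · rw [indicator_of_mem (show x ∈ Ico (min a b) (max a b) from
        ⟨(min_le_left _ _).trans ha, lt_max_of_lt_right (not_le.1 hb)⟩)]
      simp [ha, hb]
    · rw [indicator_of_mem (show x ∈ Ico (min a b) (max a b) from
        ⟨(min_le_right _ _).trans hb, lt_max_of_lt_left (not_le.1 ha)⟩)]
      simp [ha, hb]
    · simp [ha, hb]
  refine (lintegral_mono h).trans (le_of_eq ?_)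
  rw [lintegral_indicator_const measurableSet_Ico, Real.volume_Ico, max_sub_min_eq_abs']

lemma lintegral_profile_sub_le (u : State) {F : List Front} {s t d : ℝ}
    (hd : ∀ f ∈ F, |f.path t - f.path s| ≤ d) :
    ∫⁻ x, ‖profile u F t x - profile u F s x‖ₑ ∂volume ≤ ENNReal.ofReal (totalJump F * d) := by
  induction F with
  | nil => simp [profile]
  | cons f F ih =>
    have hd0 : 0 ≤ d := (abs_nonneg _).trans (hd f (by simp))
    have h1 : ∀ x, ‖profile u (f :: F) t x - profile u (f :: F) s x‖ₑ ≤
        ‖(if f.path t ≤ x then f.right - f.left else 0) -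
          (if f.path s ≤ x then f.right - f.left else 0)‖ₑ +
        ‖profile u F t x - profile u F s x‖ₑ := by
      intro x
      refine le_trans (le_of_eq ?_) (enorm_add_le _ _)
      congr 1
      simp only [profile, List.map_cons, List.sum_cons]
      abel
    have h2 : totalJump (f :: F) = ‖f.right - f.left‖ + totalJump F := by simp [totalJump]
    refine (lintegral_mono h1).trans ?_
    have h3 : Measurable fun x => ‖profile u F t x - profile u F s x‖ₑ :=
      ((measurable_profile u F t).sub (measurable_profile u F s)).enorm
    rw [lintegral_add_right _ h3, h2, add_mul, ENNReal.ofReal_add (mul_nonneg (norm_nonneg _) hd0)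
        (mul_nonneg (totalJump_nonneg F) hd0)]
    refine add_le_add ((lintegral_step_sub_le _ _ _).trans ?_)
      (ih fun g hg => hd g (by simp [hg]))
    rw [ENNReal.ofReal_mul (norm_nonneg _), ofReal_norm]
    gcongr
    exact hd f (by simp)

lemma abs_exp_neg_sub_le {x y c : ℝ} (hx : -x ≤ c) (hy : -y ≤ c) :
    |Real.exp (-x) - Real.exp (-y)| ≤ Real.exp c * |x - y| := by
  have key : ∀ a b : ℝ, a ≤ b → b ≤ c → Real.exp b - Real.exp a ≤ Real.exp c * (b - a) := by
    intro a b hab hb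
    have h1 := Real.add_one_le_exp (a - b)
    have h2 : Real.exp a = Real.exp b * Real.exp (a - b) := by rw [← Real.exp_add]; congr 1; ring
    have h3 := Real.exp_le_exp.2 hb
    have h4 := Real.exp_pos b
    have h5 := mul_le_mul_of_nonneg_left h1 h4.le
    have h6 := mul_le_mul_of_nonneg_right h3 (sub_nonneg.2 hab)
    rw [h2]
    linarith
  rcases le_total x y with h | h
  · rw [abs_of_nonneg (sub_nonneg.2 (Real.exp_le_exp.2 (neg_le_neg h))), abs_of_nonpos (by linarith)]
    have := key (-y) (-x) (neg_le_neg h) hx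
    linarith
  · rw [abs_of_nonpos (sub_nonpos.2 (Real.exp_le_exp.2 (neg_le_neg h))), abs_of_nonneg (by linarith)]
    have := key (-x) (-y) (neg_le_neg h) hy
    linarith

lemma specVol_eq_exp {u : State} (h : 0 < specVol u) : specVol u = Real.exp (-(toWV u).1) := by
  simp [toWV, Real.exp_log h]

/-- The total jump is controlled by the functional; `-c` is a lower bound for `w` at `-∞`. -/
lemma IsPattern.totalJump_le {lam δ t R c : ℝ} {u : State} {F : List Front}
    (hF : IsPattern lam δ R u t F) (hc : -c ≤ (toWV u).1) :
    totalJump F ≤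
      (Real.exp (c + 2 * R) + Real.cosh R) * potential (1 + 1 / Real.cosh R) F := by
  have hξ := one_le_shockWeight R
  have key : ∀ f ∈ F, ‖f.right - f.left‖ ≤
      (Real.exp (c + 2 * R) + Real.cosh R) * weight (1 + 1 / Real.cosh R) (strength f) := by
    intro f hf
    have hv := hF.valid f hf
    have hl := (abs_le.1 (hF.states_bound hf (Or.inl rfl)).1).1
    have hr := (abs_le.1 (hF.states_bound hf (Or.inr rfl)).1).1
    have h1 := hv.abs_w_sub_le hξ
    have h2 := hv.abs_v_sub_le hξ (hF.strength_le hf)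
    have h3 := abs_exp_neg_sub_le (x := (toWV f.right).1) (y := (toWV f.left).1)
      (c := c + 2 * R) (by linarith) (by linarith)
    rw [← specVol_eq_exp hv.specVol_left, ← specVol_eq_exp hv.specVol_right] at h3
    refine (norm_state_le _).trans ?_
    rw [specVol_sub, vel_sub, add_mul]
    exact add_le_add
      (h3.trans (mul_le_mul_of_nonneg_left h1 (Real.exp_pos _).le)) h2
  have : ∀ G : List Front, (∀ f ∈ G, f ∈ F) → totalJump G ≤
      (Real.exp (c + 2 * R) + Real.cosh R) * potential (1 + 1 / Real.cosh R) G := by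
    intro G hG
    induction G with
    | nil => simp [totalJump]
    | cons g G ih =>
      have h2 : totalJump (g :: G) = ‖g.right - g.left‖ + totalJump G := by simp [totalJump]
      rw [h2, potential_cons, mul_add]
      exact add_le_add (key g (hG g (by simp))) (ih fun f hf => hG f (by simp [hf]))
  exact this F fun _ h => h

/-! ### The initial data -/

/-- The sum of the sizes of the jumps of a step function. -/
def stepVariation : State → List (ℝ × State) → ℝ
  | _, [] => 0
  | u, j :: J => ‖j.2 - u‖ + stepVariation j.2 J

lemma stepVariation_nonneg (u : State) (J : List (ℝ × State)) : 0 ≤ stepVariation u J := by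
  induction J generalizing u with
  | nil => exact le_rfl
  | cons j J ih => exact add_nonneg (norm_nonneg _) (ih _)

lemma foldl_step_of_lt {J : List (ℝ × State)} {x : ℝ} (h : ∀ j ∈ J, x < j.1) (u : State) :
    J.foldl (fun u j => if j.1 ≤ x then j.2 else u) u = u := by
  induction J with
  | nil => rfl
  | cons j J ih =>
    rw [List.foldl_cons, if_neg (h j (by simp)).not_ge]
    exact ih fun k hk => h k (by simp [hk])

lemma exists_lt_forall_jumps (J : List (ℝ × State)) : ∃ c, ∀ j ∈ J, c < j.1 := by
  induction J with
  | nil => exact ⟨0, by simp⟩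
  | cons j J ih =>
    obtain ⟨c, hc⟩ := ih
    refine ⟨min c (j.1 - 1), fun k hk => ?_⟩
    rcases List.mem_cons.1 hk with rfl | hk
    · exact (min_le_right _ _).trans_lt (by linarith)
    · exact (min_le_left _ _).trans_lt (hc k hk)

/-- Every representative of a step function attains the values of the step function between
consecutive jumps, so its variation is at least the sum of the jumps. -/
lemma stepVariation_le_eVariationOn {g : ℝ → State} {J : List (ℝ × State)} {u : State} {c : ℝ}
    (hg : ∀ᵐ x ∂volume, c < x → g x = J.foldl (fun u j => if j.1 ≤ x then j.2 else u) u)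
    (hJ : J.Pairwise fun a b => a.1 < b.1) (hc : ∀ j ∈ J, c < j.1) :
    ∃ y, c < y ∧ g y = u ∧ ENNReal.ofReal (stepVariation u J) ≤ eVariationOn g (Ici y) := by
  induction J generalizing u c with
  | nil =>
    obtain ⟨y, hy, hcy⟩ := (Measure.dense_of_ae hg).exists_gt c
    exact ⟨y, hcy, hy hcy, by simp [stepVariation]⟩
  | cons j J ih =>
    obtain ⟨h1, h2⟩ := List.pairwise_cons.1 hJ
    have hcj := hc j (by simp)
    obtain ⟨z, hz, hgz, hvar⟩ := ih (u := j.2) (c := j.1) (hg.mono fun x hx hjx => by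
      rw [hx (hcj.trans hjx), List.foldl_cons, if_pos hjx.le]) h2 h1
    obtain ⟨y, hy, hcy, hyj⟩ := (Measure.dense_of_ae hg).exists_between hcj
    have hgy : g y = u := by
      rw [hy hcy]
      refine foldl_step_of_lt (fun k hk => ?_) u
      rcases List.mem_cons.1 hk with rfl | hk
      · exact hyj
      · exact hyj.trans (h1 k hk)
    refine ⟨y, hcy, hgy, ?_⟩
    have hyz : y < z := hyj.trans hz
    calc ENNReal.ofReal (stepVariation u (j :: J))
        = ‖j.2 - u‖ₑ + ENNReal.ofReal (stepVariation j.2 J) := by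
          rw [stepVariation, ENNReal.ofReal_add (norm_nonneg _) (stepVariation_nonneg _ _),
            ofReal_norm]
      _ ≤ eVariationOn g (Icc y z) + eVariationOn g (Ici z) := by
          refine add_le_add ?_ hvar
          rw [← hgy, ← hgz, ← edist_eq_enorm_sub]
          exact eVariationOn.edist_le g (right_mem_Icc.2 hyz.le) (left_mem_Icc.2 hyz.le)
      _ ≤ eVariationOn g (Icc y z ∪ Ici z) :=
          eVariationOn.add_le_union g fun a ha b hb => ha.2.trans hb
      _ ≤ eVariationOn g (Ici y) := eVariationOn.mono g
          (union_subset (fun a ha => ha.1) (Ici_subset_Ici.2 hyz.le))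

lemma bvNorm_le_eVariationOn (f : ℝ → State) : bvNorm f ≤ eVariationOn f univ :=
  iInf₂_le (f := fun (g : ℝ → State) (_ : g =ᵐ[volume] f) => eVariationOn g univ) f
    (ae_eq_refl f)

lemma StepData.stepVariation_le_bvNorm (ψ₀ : StepData) :
    ENNReal.ofReal (stepVariation ψ₀.base ψ₀.jumps) ≤ bvNorm ψ₀.toFun := by
  refine le_iInf₂ fun g hg => ?_
  obtain ⟨c, hc⟩ := exists_lt_forall_jumps ψ₀.jumps
  obtain ⟨y, -, -, h⟩ := stepVariation_le_eVariationOn (g := g) (u := ψ₀.base) (c := c)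
    (hg.mono fun x hx _ => hx) ψ₀.sorted hc
  exact h.trans (eVariationOn.mono g (subset_univ _))

lemma StepData.base_norm_le (ψ₀ : StepData) {A : ℝ} (hA : 0 ≤ A)
    (h : eLpNorm ψ₀.toFun ⊤ volume ≤ ENNReal.ofReal A) : ‖ψ₀.base‖ ≤ A := by
  have hae : ∀ᵐ x ∂volume, ‖ψ₀.toFun x‖ₑ ≤ ENNReal.ofReal A := by
    rw [eLpNorm_exponent_top] at h
    exact (ae_le_eLpNormEssSup (f := ψ₀.toFun)).mono fun x hx => hx.trans h
  obtain ⟨c, hc⟩ := exists_lt_forall_jumps ψ₀.jumps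
  obtain ⟨y, hy, hyc⟩ := (Measure.dense_of_ae hae).exists_lt c
  have : ψ₀.toFun y = ψ₀.base := foldl_step_of_lt (fun j hj => lt_trans hyc (hc j hj)) _
  rw [mem_ofPred_eq, this, ← ofReal_norm] at hy
  exact (ENNReal.ofReal_le_ofReal_iff hA).1 hy

lemma le_specVol_of_foldl {β : ℝ} {J : List (ℝ × State)} {u : State} {c : ℝ}
    (h : ∀ x ≥ c, β ≤ specVol (J.foldl (fun u j => if j.1 ≤ x then j.2 else u) u))
    (hJ : J.Pairwise fun a b => a.1 < b.1) (hc : ∀ j ∈ J, c < j.1) :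
    β ≤ specVol u ∧ ∀ j ∈ J, β ≤ specVol j.2 := by
  induction J generalizing u c with
  | nil => exact ⟨h c le_rfl, by simp⟩
  | cons j J ih =>
    obtain ⟨h1, h2⟩ := List.pairwise_cons.1 hJ
    have hcj := hc j (by simp)
    have h3 := ih (u := j.2) (c := j.1) (fun x hx => by
      have := h x (hcj.le.trans hx)
      rwa [List.foldl_cons, if_pos hx] at this) h2 h1
    refine ⟨?_, List.forall_mem_cons.2 h3⟩
    have := h c le_rfl
    rwa [foldl_step_of_lt hc] at this

lemma StepData.le_specVol (ψ₀ : StepData) {β : ℝ} (h : ∀ x, β ≤ specVol (ψ₀.toFun x)) :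
    β ≤ specVol ψ₀.base ∧ ∀ j ∈ ψ₀.jumps, β ≤ specVol j.2 := by
  obtain ⟨c, hc⟩ := exists_lt_forall_jumps ψ₀.jumps
  exact le_specVol_of_foldl (fun x _ => h x) ψ₀.sorted hc

lemma abs_log_sub_log_le {β x y : ℝ} (hβ : 0 < β) (hx : β ≤ x) (hy : β ≤ y) :
    |Real.log x - Real.log y| ≤ 1 / β * |x - y| := by
  have key : ∀ a b : ℝ, β ≤ a → a ≤ b → Real.log b - Real.log a ≤ 1 / β * (b - a) := by
    intro a b ha hab
    have ha0 := hβ.trans_le ha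
    rw [← Real.log_div (ha0.trans_le hab).ne' ha0.ne']
    refine (Real.log_le_sub_one_of_pos (div_pos (ha0.trans_le hab) ha0)).trans ?_
    rw [div_sub_one ha0.ne', div_eq_mul_one_div, mul_comm]
    exact mul_le_mul_of_nonneg_right (one_div_le_one_div_of_le hβ ha) (sub_nonneg.2 hab)
  rcases le_total x y with h | h
  · rw [abs_sub_comm, abs_sub_comm x, abs_of_nonneg (sub_nonneg.2 h), abs_of_nonneg
      (sub_nonneg.2 (Real.log_le_log (hβ.trans_le hx) h))]
    exact key x y hx h
  · rw [abs_of_nonneg (sub_nonneg.2 h), abs_of_nonneg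
      (sub_nonneg.2 (Real.log_le_log (hβ.trans_le hy) h))]
    exact key y x hy h

/-- The fronts at time `0` form a chain of valid fronts, and the functional is bounded by the
variation of the initial datum. -/
lemma IsInitialPattern.spec {ε lam δ β ξ : ℝ} (hδ : 0 < δ) (hβ : 0 < β) (hξ : ξ ≤ 2) {u : State}
    {J : List (ℝ × State)} {F : List Front} (hu : β ≤ specVol u) (hJ : ∀ j ∈ J, β ≤ specVol j.2)
    (hF : IsInitialPattern ε lam δ u J F) :
    (∃ v, Joins u F v) ∧ (∀ f ∈ F, IsValid lam δ 0 f) ∧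
      potential ξ F ≤ 2 * (1 / β + 1) * stepVariation u J := by
  induction J generalizing u F with
  | nil =>
    obtain rfl : F = [] := hF
    exact ⟨⟨u, rfl⟩, by simp, by simp [stepVariation]⟩
  | cons j J ih =>
    obtain ⟨G, H, rfl, hG, hH⟩ := hF
    have hj := hJ j (by simp)
    obtain ⟨⟨v, hv⟩, hval, hpot⟩ := ih hj (fun k hk => hJ k (by simp [hk])) hH
    obtain ⟨σ₁, σ₂, _, _, _, e1, e2, gJ, gV, gpot, _⟩ := hG.spec hδ (hβ.trans_le hu) ξ
    refine ⟨⟨v, joins_append.2 ⟨_, gJ, hv⟩⟩, fun f hf => ?_, ?_⟩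
    · rcases List.mem_append.1 hf with hf | hf
      · exact (gV f hf).1
      · exact hval f hf
    · have h1 : |σ₁| + |σ₂| ≤ (1 / β + 1) * ‖j.2 - u‖ := by
        refine abs_add_abs_le.trans ?_
        rw [e1, e2, add_mul, one_mul]
        refine add_le_add ?_ ?_
        · have h2 := abs_log_sub_log_le hβ hu hj
          have h3 := abs_specVol_le (j.2 - u)
          rw [specVol_sub, abs_sub_comm] at h3
          have h4 : 0 ≤ 1 / β := (one_div_pos.2 hβ).le
          simp only [toWV]
          rw [neg_sub_neg]
          exact h2.trans (mul_le_mul_of_nonneg_left h3 h4)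
        · have h3 := abs_vel_le (j.2 - u)
          rwa [vel_sub, abs_sub_comm] at h3
      have h5 := weight_le_mul_abs (σ := σ₁) hξ one_le_two
      have h6 := weight_le_mul_abs (σ := σ₂) hξ one_le_two
      rw [potential_append, gpot, stepVariation, mul_add]
      linarith

/-! ### The front tracking approximation -/

namespace FrontTracking

variable {ε lam δ R : ℝ} {ψ₀ : StepData}

lemma time_le (P : FrontTracking ε lam δ ψ₀) {i j : ℕ} (hij : i ≤ j) (hj : (j : ℕ∞) ≤ P.N) :
    P.time i ≤ P.time j := by
  induction j, hij using Nat.le_induction with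
  | base => exact le_rfl
  | succ j _ ih =>
    have hj' : (j : ℕ∞) < P.N := lt_of_lt_of_le (by exact_mod_cast j.lt_succ_self) hj
    exact (ih hj'.le).trans (P.time_lt j hj').le

lemma potential_le (P : FrontTracking ε lam δ ψ₀) (hδ : 0 < δ)
    (h0 : IsPattern lam δ R ψ₀.base 0 (P.fronts 0)) {k : ℕ} (hk : (k : ℕ∞) ≤ P.N) :
    potential (1 + 1 / Real.cosh R) (P.fronts k) ≤
      potential (1 + 1 / Real.cosh R) (P.fronts 0) := by
  induction k with
  | zero => exact le_rfl
  | succ k ih =>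
    have hk' : (k : ℕ∞) < P.N := lt_of_lt_of_le (by exact_mod_cast k.lt_succ_self) hk
    obtain ⟨_, _, _, _, _, _, _, _, _, _, _, _, h, _⟩ :=
      (P.isPattern hδ h0 k hk'.le).interaction hδ (P.time_lt k hk')
        (P.separated k hk') (P.interaction k hk')
    exact h.trans (ih hk'.le)

/-- The fronts are ordered at all times of a stage; at its beginning, by continuity. -/
lemma pairwise_le (P : FrontTracking ε lam δ ψ₀) {k : ℕ} {t : ℝ} (hk : P.IsStage t k)
    (hF : IsPattern lam δ R ψ₀.base (P.time k) (P.fronts k)) :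
    (P.fronts k).Pairwise fun f g => f.path t ≤ g.path t := by
  have hsep : ∃ r > P.time k, ∀ s ∈ Ioo (P.time k) r, Separated (P.fronts k) s := by
    rcases hk.1.lt_or_eq with h | h
    · exact ⟨_, P.time_lt k h, P.separated k h⟩
    · exact ⟨P.time k + 1, by linarith, fun s hs => P.separated_last k h s hs.1⟩
  rcases hk.2.1.eq_or_lt with rfl | ht
  · obtain ⟨r, hr, hsep⟩ := hsep
    rw [List.pairwise_iff_getElem]
    intro i j hi hj hij
    have hcont : ∀ f ∈ P.fronts k,
        Filter.Tendsto f.path (nhdsWithin (P.time k) (Ioi (P.time k))) (nhds (f.path (P.time k))) :=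
      fun f hf => (((hF.valid f hf).continuousOn _ self_mem_Ici).mono Ioi_subset_Ici_self)
    refine le_of_tendsto_of_tendsto (hcont _ (List.getElem_mem hi)) (hcont _ (List.getElem_mem hj))
      ?_
    filter_upwards [Ioo_mem_nhdsGT hr] with s hs
    exact (List.pairwise_iff_getElem.1 (hsep s hs) i j hi hj hij).le
  · have : Separated (P.fronts k) t := by
      rcases hk.1.lt_or_eq with h | h
      · exact P.separated k h t ⟨ht, hk.2.2 h⟩
      · exact P.separated_last k h t ht
    exact this.imp fun h => h.le

lemma approx_eq (P : FrontTracking ε lam δ ψ₀) {t : ℝ} (h : ∃ k, P.IsStage t k) :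
    ∃ k, P.IsStage t k ∧ ∀ x, P.approx t x =
      (P.fronts k).foldl (fun u f => if f.path t ≤ x then f.right else u) ψ₀.base :=
  ⟨h.choose, h.choose_spec, fun x => by rw [approx, dif_pos h]⟩

lemma approx_eq_profile (P : FrontTracking ε lam δ ψ₀) (hδ : 0 < δ)
    (h0 : IsPattern lam δ R ψ₀.base 0 (P.fronts 0)) {t : ℝ} (h : ∃ k, P.IsStage t k) :
    ∃ k, P.IsStage t k ∧ P.approx t = profile ψ₀.base (P.fronts k) t := by
  obtain ⟨k, hk, heq⟩ := P.approx_eq h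
  have hF := P.isPattern hδ h0 k hk.1
  obtain ⟨v, hJ⟩ := hF.joins
  exact ⟨k, hk, funext fun x => (heq x).trans (foldl_eq_profile hJ (P.pairwise_le hk hF) x)⟩

/-- At the time of an interaction the fronts before and after it describe the same function. -/
lemma profile_interaction (P : FrontTracking ε lam δ ψ₀) (hδ : 0 < δ)
    (h0 : IsPattern lam δ R ψ₀.base 0 (P.fronts 0)) {k : ℕ} (hk : (k : ℕ∞) < P.N) :
    profile ψ₀.base (P.fronts k) (P.time (k + 1)) =
      profile ψ₀.base (P.fronts (k + 1)) (P.time (k + 1)) := by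
  obtain ⟨A, B, G, f, g, e1, e2, c1, c2, c3, c4, -⟩ :=
    (P.isPattern hδ h0 k hk.le).interaction hδ (P.time_lt k hk)
      (P.separated k hk) (P.interaction k hk)
  rw [e1, e2]
  exact profile_congr c1 c2 c3 c4

/-- The `L¹` distance of the profiles at two times is at most the maximal total jump times the
maximal speed times the time elapsed, also across interactions. -/
lemma lintegral_profile_sub_le (P : FrontTracking ε lam δ ψ₀) (hδ : 0 < δ)
    (h0 : IsPattern lam δ R ψ₀.base 0 (P.fronts 0)) {b C s : ℝ} (hb : (toWV ψ₀.base).1 ≤ b)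
    (hlam : 0 ≤ lam) (hC : ∀ k : ℕ, (k : ℕ∞) ≤ P.N → totalJump (P.fronts k) ≤ C) {l k : ℕ}
    (hlk : l ≤ k) (hkN : (k : ℕ∞) ≤ P.N) (hls : P.time l ≤ s)
    (hsl : ∀ j, l < j → (j : ℕ∞) ≤ P.N → s ≤ P.time j) {t : ℝ} (hkt : P.time k ≤ t) (hst : s ≤ t) :
    ∫⁻ x, ‖profile ψ₀.base (P.fronts k) t x - profile ψ₀.base (P.fronts l) s x‖ₑ ∂volume ≤
      ENNReal.ofReal (C * (max lam (Real.exp (b + 2 * R)) * (t - s))) := by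
  set Λ := max lam (Real.exp (b + 2 * R))
  have hΛ : 0 ≤ Λ := hlam.trans (le_max_left _ _)
  have hone : ∀ (k : ℕ) (r t : ℝ), (k : ℕ∞) ≤ P.N → P.time k ≤ r → r ≤ t →
      ∫⁻ x, ‖profile ψ₀.base (P.fronts k) t x - profile ψ₀.base (P.fronts k) r x‖ₑ ∂volume ≤
        ENNReal.ofReal (C * (Λ * (t - r))) := by
    intro k r t hk hr hrt
    refine (_root_.lintegral_profile_sub_le _ fun f hf =>
      ((P.isPattern hδ h0 k hk).moves hb hf).abs_sub_le hr hrt).trans ?_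
    exact ENNReal.ofReal_le_ofReal
      (mul_le_mul_of_nonneg_right (hC k hk) (mul_nonneg hΛ (sub_nonneg.2 hrt)))
  have hC0 : 0 ≤ C := (totalJump_nonneg _).trans (hC k hkN)
  induction k, hlk using Nat.le_induction generalizing t with
  | base => exact hone l s t hkN hls hst
  | succ k hlk ih =>
    have hk' : (k : ℕ∞) < P.N := lt_of_lt_of_le (by exact_mod_cast k.lt_succ_self) hkN
    have hsk : s ≤ P.time (k + 1) := hsl (k + 1) (by omega) hkN
    have h1 := ih hk'.le (P.time_lt k hk').le hsk
    have h2 := hone (k + 1) _ t hkN le_rfl hkt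
    rw [P.profile_interaction hδ h0 hk'] at h1
    have h3 : ENNReal.ofReal (C * (Λ * (t - s))) = ENNReal.ofReal (C * (Λ * (t - P.time (k + 1)))) +
        ENNReal.ofReal (C * (Λ * (P.time (k + 1) - s))) := by
      rw [← ENNReal.ofReal_add (mul_nonneg hC0 (mul_nonneg hΛ (sub_nonneg.2 hkt)))
        (mul_nonneg hC0 (mul_nonneg hΛ (sub_nonneg.2 hsk)))]
      congr 1
      ring
    rw [h3]
    refine le_trans ?_ (add_le_add h2 h1)
    have h4 : Measurable fun x => ‖profile ψ₀.base (P.fronts (k + 1)) t x -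
        profile ψ₀.base (P.fronts (k + 1)) (P.time (k + 1)) x‖ₑ :=
      ((measurable_profile _ _ _).sub (measurable_profile _ _ _)).enorm
    rw [← lintegral_add_left h4]
    refine lintegral_mono fun x => ?_
    refine le_trans (le_of_eq ?_) (enorm_add_le _ _)
    congr 1
    abel

lemma lintegral_approx_sub_le (P : FrontTracking ε lam δ ψ₀) (hδ : 0 < δ)
    (h0 : IsPattern lam δ R ψ₀.base 0 (P.fronts 0)) {b C s t : ℝ} (hb : (toWV ψ₀.base).1 ≤ b)
    (hlam : 0 ≤ lam) (hC : ∀ k : ℕ, (k : ℕ∞) ≤ P.N → totalJump (P.fronts k) ≤ C) (hs : 0 ≤ s)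
    (hst : s ≤ t) :
    ∫⁻ x, ‖P.approx t x - P.approx s x‖ₑ ∂volume ≤
      ENNReal.ofReal (C * (max lam (Real.exp (b + 2 * R)) * (t - s))) := by
  obtain ⟨l, hl, hls⟩ := P.approx_eq_profile hδ h0 (P.exists_isStage hlam hδ h0 hs)
  obtain ⟨k, hk, hkt⟩ := P.approx_eq_profile hδ h0 (P.exists_isStage hlam hδ h0 (hs.trans hst))
  have hsl : ∀ j, l < j → (j : ℕ∞) ≤ P.N → s < P.time j := fun j hlj hj =>
    (hl.2.2 (lt_of_lt_of_le (by exact_mod_cast hlj) hj)).trans_le (P.time_le hlj hj)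
  have hlk : l ≤ k := by
    by_contra! h
    have hkN : (k : ℕ∞) < P.N := lt_of_lt_of_le (by exact_mod_cast h) hl.1
    have h1 := hk.2.2 hkN
    have h2 := P.time_le (i := k + 1) h hl.1
    linarith [hl.2.1]
  rw [hls, hkt]
  exact P.lintegral_profile_sub_le hδ h0 hb hlam hC hlk hk.1 hl.2.1
    (fun j h1 h2 => (hsl j h1 h2).le) hk.2.1 hst

end FrontTracking

/-! ### The values of the approximation -/

lemma foldl_mem (F : List Front) (u : State) (t x : ℝ) :
    F.foldl (fun u f => if f.path t ≤ x then f.right else u) u = u ∨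
      ∃ f ∈ F, F.foldl (fun u f => if f.path t ≤ x then f.right else u) u = f.right := by
  induction F generalizing u with
  | nil => exact Or.inl rfl
  | cons f F ih =>
    rw [List.foldl_cons]
    split_ifs
    · rcases ih f.right with h | ⟨g, hg, h⟩
      · exact Or.inr ⟨f, by simp, h⟩
      · exact Or.inr ⟨g, by simp [hg], h⟩
    · rcases ih u with h | ⟨g, hg, h⟩
      · exact Or.inl h
      · exact Or.inr ⟨g, by simp [hg], h⟩

lemma continuous_ofWV : Continuous ofWV := by
  unfold ofWV
  refine (PiLp.continuous_toLp 2 _).comp (continuous_pi fun i => ?_)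
  fin_cases i
  · exact (Real.continuous_exp.comp continuous_fst.neg)
  · exact continuous_snd

end

theorem lemma5p1 (A V β : ℝ) (hβ : 0 < β) :
    ∃ D : Set State, IsCompact D ∧ (∀ u ∈ D, 0 < specVol u) ∧
    ∀ lam : ℝ, 0 < lam →
    ∃ M : ℝ, 0 < M ∧
    ∀ u₀ : ℝ → State,
      eLpNorm u₀ ⊤ volume ≤ ENNReal.ofReal A →
      bvNorm u₀ ≤ ENNReal.ofReal V →
      (∀ᵐ x ∂volume, β ≤ specVol (u₀ x)) →
    ∀ ε : ℝ, 0 < ε →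
    ∀ δ : ℝ, 0 < δ →
    ∀ ψ₀ : StepData,
      bvNorm ψ₀.toFun ≤ 2 * bvNorm u₀ →
      eLpNorm ψ₀.toFun ⊤ volume ≤ eLpNorm u₀ ⊤ volume →
      (∀ x, β ≤ specVol (ψ₀.toFun x)) →
    ∀ P : FrontTracking ε lam δ ψ₀,
    ∀ T : ℝ, 0 < T →
      (P.interactions T).Finite ∧
      (∀ t : ℝ, 0 ≤ t → ∀ x : ℝ, P.approx t x ∈ D) ∧
      (∀ t ∈ Icc 0 T, bvNorm (P.approx t) ≤ ENNReal.ofReal M * bvNorm u₀) ∧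
      (∀ s t : ℝ, 0 < s → s < t → t < T →
        ∫⁻ x, ‖P.approx t x - P.approx s x‖ₑ ∂volume ≤ ENNReal.ofReal (M * |t - s|)) := by
  -- `κ` compares the functional at time `0` with the variation of `u₀`; `2R` bounds the functional
  set κ : ℝ := 4 * (1 / β + 1) with hκdef
  have hκ : 0 < κ := by positivity
  set R : ℝ := κ * max V 0 / 2 with hRdef
  have hR : 0 ≤ R := by positivity
  -- at `-∞`, one has `-c ≤ w ≤ b` and `|v| ≤ A'`
  set A' : ℝ := max A β with hA'def
  have hA' : 0 < A' := hβ.trans_le (le_max_right _ _)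
  set b : ℝ := -Real.log β with hbdef
  set c : ℝ := Real.log A' with hcdef
  set q : ℝ := Real.cosh R * (2 * R) with hqdef
  have hq : 0 ≤ q := mul_nonneg (Real.cosh_pos R).le (by linarith)
  refine ⟨ofWV '' (Icc (-c - 2 * R) (b + 2 * R) ×ˢ Icc (-A' - q) (A' + q)),
    (isCompact_Icc.prod isCompact_Icc).image continuous_ofWV, ?_, fun lam hlam => ?_⟩
  · rintro _ ⟨p, -, rfl⟩
    rw [specVol_ofWV]
    exact Real.exp_pos _
  set C : ℝ := Real.exp (c + 2 * R) + Real.cosh R with hCdef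
  have hC : 0 < C := add_pos (Real.exp_pos _) (Real.cosh_pos _)
  set Λ : ℝ := max lam (Real.exp (b + 2 * R)) with hΛdef
  have hΛ : 0 < Λ := hlam.trans_le (le_max_left _ _)
  refine ⟨C * κ + C * (2 * R) * Λ, by positivity, ?_⟩
  intro u₀ hA hV _ ε _ δ hδ ψ₀ hbv hsup hτ P T _
  have hbvfin : bvNorm u₀ ≠ ⊤ := (hV.trans_lt ENNReal.ofReal_lt_top).ne
  have hbvV : (bvNorm u₀).toReal ≤ max V 0 := by
    have := ENNReal.toReal_mono ENNReal.ofReal_ne_top hV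
    rwa [ENNReal.toReal_ofReal'] at this
  have hstep : stepVariation ψ₀.base ψ₀.jumps ≤ 2 * (bvNorm u₀).toReal := by
    have h1 := ψ₀.stepVariation_le_bvNorm.trans hbv
    have h2 := ENNReal.toReal_mono (ENNReal.mul_ne_top ENNReal.ofNat_ne_top hbvfin) h1
    rwa [ENNReal.toReal_ofReal (stepVariation_nonneg _ _), ENNReal.toReal_mul,
      ENNReal.toReal_ofNat] at h2
  obtain ⟨hbase, hjumps⟩ := ψ₀.le_specVol hτ
  have hbase0 : 0 < specVol ψ₀.base := hβ.trans_le hbase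
  obtain ⟨hJ0, hV0, hpot0⟩ := P.initial.spec hδ hβ (shockWeight_le_two R) hbase hjumps
  have hpotbv : potential (1 + 1 / Real.cosh R) (P.fronts 0) ≤ κ * (bvNorm u₀).toReal := by
    refine hpot0.trans ?_
    have h2 : 0 ≤ 2 * (1 / β + 1) := by positivity
    have := mul_le_mul_of_nonneg_left hstep h2
    rw [hκdef]
    linarith
  have hpotR : κ * (bvNorm u₀).toReal ≤ 2 * R := by
    rw [hRdef]
    linarith [mul_le_mul_of_nonneg_left hbvV hκ.le]
  have h0 : IsPattern lam δ R ψ₀.base 0 (P.fronts 0) := ⟨hJ0, hV0, hpotbv.trans hpotR⟩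
  have hnorm : ‖ψ₀.base‖ ≤ A' := ψ₀.base_norm_le hA'.le
    ((hsup.trans hA).trans (ENNReal.ofReal_le_ofReal (le_max_left _ _)))
  have hwb : (toWV ψ₀.base).1 ≤ b := neg_le_neg (Real.log_le_log hβ hbase)
  have hwc : -c ≤ (toWV ψ₀.base).1 := neg_le_neg (Real.log_le_log hbase0
    ((le_abs_self _).trans ((abs_specVol_le _).trans hnorm)))
  have hvA := abs_le.1 ((abs_vel_le ψ₀.base).trans hnorm)
  have hjump : ∀ k : ℕ, (k : ℕ∞) ≤ P.N → totalJump (P.fronts k) ≤ C * (κ * (bvNorm u₀).toReal) :=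
    fun k hk => ((P.isPattern hδ h0 k hk).totalJump_le hwc).trans
      (mul_le_mul_of_nonneg_left ((P.potential_le hδ h0 hk).trans hpotbv) hC.le)
  refine ⟨P.interactions_finite hlam.le hδ h0 T, fun t ht x => ?_, fun t ht => ?_,
    fun s t hs hst _ => ?_⟩
  · obtain ⟨k, hk, heq⟩ := P.approx_eq (P.exists_isStage hlam.le hδ h0 ht)
    rw [heq x]
    have hF := P.isPattern hδ h0 k hk.1
    have hmem : ∀ z : State, 0 < specVol z → |(toWV z).1 - (toWV ψ₀.base).1| ≤ 2 * R →
        |(toWV z).2 - (toWV ψ₀.base).2| ≤ q →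
        z ∈ ofWV '' (Icc (-c - 2 * R) (b + 2 * R) ×ˢ Icc (-A' - q) (A' + q)) := by
      intro z hz h1 h2
      rw [abs_le] at h1 h2
      have h3 : (toWV ψ₀.base).2 = vel ψ₀.base := rfl
      rw [h3] at h2
      exact ⟨toWV z, ⟨⟨by linarith [h1.1], by linarith [h1.2]⟩,
        ⟨by linarith [h2.1, hvA.1], by linarith [h2.2, hvA.2]⟩⟩, ofWV_toWV hz⟩
    rcases foldl_mem (P.fronts k) ψ₀.base t x with h | ⟨f, hf, h⟩
    · rw [h]
      exact hmem _ hbase0 (by simpa using hR) (by simpa using hq)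
    · rw [h]
      obtain ⟨h1, h2⟩ := hF.states_bound hf (Or.inr rfl)
      exact hmem _ (hF.valid f hf).specVol_right h1 h2
  · obtain ⟨k, hk, heq⟩ := P.approx_eq_profile hδ h0 (P.exists_isStage hlam.le hδ h0 ht.1)
    rw [heq]
    refine (bvNorm_le_eVariationOn _).trans ((eVariationOn_profile_le _ _ _).trans ?_)
    rw [← ENNReal.ofReal_toReal hbvfin, ← ENNReal.ofReal_mul (by positivity)]
    refine ENNReal.ofReal_le_ofReal ((hjump k hk.1).trans ?_)
    rw [← mul_assoc]
    exact mul_le_mul_of_nonneg_right (le_add_of_nonneg_right (by positivity))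
      ENNReal.toReal_nonneg
  · refine (P.lintegral_approx_sub_le hδ h0 hwb hlam.le (fun k hk => (hjump k hk).trans
      (mul_le_mul_of_nonneg_left hpotR hC.le)) hs.le hst.le).trans
      (ENNReal.ofReal_le_ofReal ?_)
    rw [abs_of_pos (sub_pos.2 hst), ← mul_assoc]
    exact mul_le_mul_of_nonneg_right (le_add_of_nonneg_left (by positivity))
      (sub_pos.2 hst).le
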